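/- Let $W=\{W(t,x)\}_{t\ge 0,\,x\in[0,1]}$ be the Brownian sheet of a space-time white noise on a probability space $(\Omega,\mathcal F,\mathbb P)$, $\lambda>0$, $\sigma:\mathbb R\to\mathbb R$ Lipschitz with Lipschitz constant $L_\sigma$, and $u_0:[0,1]\to[0,\infty)$ bounded and measurable. Fix $\theta\in[0,1]$. For an integer $n\ge 3$ and $0<\tau<1$ put $t_i=i\tau$, $x_j=j/n$, and consider the fully discrete $\theta$-scheme with periodic boundary condition for $\partial_t u=\partial_x^2u+\lambda\sigma(u)\dot W$, $u(0,\cdot)=u_0$: for $i\ge 0$ and $j=0,\dots,n-1$, almost surely, $$u^{n,\tau}(t_{i+1},x_j)=u^{n,\tau}(t_i,x_j)+(1-\theta)\tau\,\Delta_nu^{n,\tau}(t_i,\cdot)(x_j)+\theta\tau\,\Delta_nu^{n,\tau}(t_{i+1},\cdot)(x_j)+\lambda\tau\,\sigma(u^{n,\tau}(t_i,x_j))\,\square_{n,\tau}W(t_i,x_j),$$ $u^{n,\tau}(0,x_j)=u_0(x_j)$, with $u^{n,\tau}(t_i,\cdot)$ extended from the grid points periodically with period $1$, where $$\Delta_nv(x_j)=n^2\big(v(x_{j+1})-2v(x_j)+v(x_{j-1})\big),$$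 $$\square_{n,\tau}W(t_i,x_j)=n\tau^{-1}\big(W(t_{i+1},x_{j+1})-W(t_i,x_{j+1})-W(t_{i+1},x_j)+W(t_i,x_j)\big),$$ and $u^{n,\tau}(t_i,\cdot)$ is extended to $[0,1]$ by linear interpolation between neighbouring grid points. For $x\in[0,1]$ and $p>0$ let $$\bar\gamma^{n,\tau}_p(x)=\limsup_{m\to\infty}\frac1{m\tau}\log\mathbb E\big(|u^{n,\tau}(m\tau,x)|^p\big)\in[-\infty,\infty].$$ Assume the step-size condition: if $\theta<\frac12$, then $n^2\tau\le r<\frac1{2-4\theta}$ for some $r>0$; if $\theta=\frac12$, then $n^2\tau\le\frac1\epsilon-\frac12$ for some $\epsilon\in(0,\frac12)$; if $\theta>\frac12$, nothing is required. Then the scheme has a solution $u^{n,\tau}$, and every solution has the following properties. (a) For every $\ell>0$ there is a constant $C=C(\theta,\ell)>0$, which does not depend on $n,\tau,p,\lambda,\sigma,u_0$, such that, whenever $\lambda L_\sigma\ge\ell$ or $L_\sigma=0$, $$\sup_{x\in[0,1]}\bar\gamma^{n,\tau}_p(x)\le CL_\sigma^4\lambda^4p^3\qquad\text{for all }p\in[2,\infty).$$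 (b) If in addition $I_0:=\inf_{x\in[0,1]}u_0(x)>0$ and $J_0:=\inf_{x\ne0}|\sigma(x)/x|>0$, then $u^{n,\tau}$ is weakly intermittent, that is, $\bar\gamma^{n,\tau}_2(x)>0$ and $\bar\gamma^{n,\tau}_p(x)<\infty$ for all $x\in[0,1]$ and all $p>2$; moreover $$\inf_{x\in[0,1]}\bar\gamma^{n,\tau}_2(x)\ge\frac{\log(1+\lambda^2J_0^2\tau)}{\tau}>0.$$ -/

import Mathlib

open MeasureTheory ProbabilityTheory Filter
open scoped ENNReal NNReal

namespace ThetaScheme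

/-- `W` is (a version of) the Brownian sheet on `[0, ∞) × [0, 1]`, i.e. the distribution function
`W(t, x) = ∫₀ᵗ ∫₀ˣ dW` of space-time white noise: a centred Gaussian field with covariance
`E[W(s, x) W(t, y)] = min s t * min x y`. Values of `W` outside `[0, ∞) × [0, 1]` are irrelevant. -/
structure IsBrownianSheet {Ω : Type*} [MeasurableSpace Ω] (P : Measure Ω)
    (W : ℝ → ℝ → Ω → ℝ) : Prop where
  gaussian : IsGaussianProcess
    (fun q : (Set.Ici (0 : ℝ) ×ˢ Set.Icc (0 : ℝ) 1 : Set (ℝ × ℝ)) => W q.1.1 q.1.2) P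
  mean : ∀ t x : ℝ, 0 ≤ t → x ∈ Set.Icc (0 : ℝ) 1 → ∫ ω, W t x ω ∂P = 0
  cov : ∀ s t x y : ℝ, 0 ≤ s → 0 ≤ t → x ∈ Set.Icc (0 : ℝ) 1 → y ∈ Set.Icc (0 : ℝ) 1 →
    covariance (W s x) (W t y) P = min s t * min x y

/-- The discrete Laplacian with periodic boundary condition; grid functions are indexed by
`ZMod n`, the index `j` standing for the grid point `j / n`. -/
def discreteLaplacian (n : ℕ) (v : ZMod n → ℝ) (j : ZMod n) : ℝ :=
  (n : ℝ) ^ 2 * (v (j + 1) - 2 * v j + v (j - 1))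

/-- The grid point `x_j = j / n ∈ [0, 1)`, with the representative `j ∈ {0, …, n - 1}`. -/
noncomputable def gridPoint (n : ℕ) (j : ZMod n) : ℝ := (j.val : ℝ) / n

/-- The difference quotient `n τ⁻¹ (W(t_{i+1}, x_{j+1}) - W(t_i, x_{j+1}) - W(t_{i+1}, x_j)
+ W(t_i, x_j))` of the sheet, where `t_i = i τ`, `x_j = j / n` and `x_{j+1} = x_j + 1 / n`. -/
noncomputable def noiseIncrement {Ω : Type*} (n : ℕ) (τ : ℝ) (W : ℝ → ℝ → Ω → ℝ)
    (i : ℕ) (j : ZMod n) (ω : Ω) : ℝ :=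
  (n : ℝ) * τ⁻¹ *
    (W (((i : ℝ) + 1) * τ) (((j.val : ℝ) + 1) / n) ω - W ((i : ℝ) * τ) (((j.val : ℝ) + 1) / n) ω
      - W (((i : ℝ) + 1) * τ) ((j.val : ℝ) / n) ω + W ((i : ℝ) * τ) ((j.val : ℝ) / n) ω)

/-- `U i j = u^{n,τ}(t_i, x_j)` solves (almost surely) the fully discrete scheme, finite
differences in space and the `θ`-scheme in time. -/
structure IsSolution {Ω : Type*} [MeasurableSpace Ω] (P : Measure Ω) (W : ℝ → ℝ → Ω → ℝ)
    (θ lam : ℝ) (σ u₀ : ℝ → ℝ) (n : ℕ) (τ : ℝ) (U : ℕ → ZMod n → Ω → ℝ) : Prop where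
  initial : ∀ᵐ ω ∂P, ∀ j : ZMod n, U 0 j ω = u₀ (gridPoint n j)
  step : ∀ᵐ ω ∂P, ∀ (i : ℕ) (j : ZMod n),
    U (i + 1) j ω = U i j ω
      + (1 - θ) * τ * discreteLaplacian n (fun k => U i k ω) j
      + θ * τ * discreteLaplacian n (fun k => U (i + 1) k ω) j
      + lam * τ * σ (U i j ω) * noiseIncrement n τ W i j ω

/-- Piecewise linear interpolation in space of a periodic grid field. For `x ∈ [0, 1]` and
`κ_n(x) = ⌊n x⌋ / n` this is
`u(t_i, κ_n(x)) + n (x - κ_n(x)) (u(t_i, κ_n(x) + 1 / n) - u(t_i, κ_n(x)))`. -/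
noncomputable def interpolate {Ω : Type*} (n : ℕ) (U : ℕ → ZMod n → Ω → ℝ)
    (i : ℕ) (x : ℝ) (ω : Ω) : ℝ :=
  U i (⌊(n : ℝ) * x⌋ : ZMod n) ω
    + ((n : ℝ) * x - ⌊(n : ℝ) * x⌋)
      * (U i ((⌊(n : ℝ) * x⌋ : ZMod n) + 1) ω - U i (⌊(n : ℝ) * x⌋ : ZMod n) ω)

/-- The upper `p`-th moment Lyapunov exponent
`limsup_{m → ∞} (1 / (m τ)) log E |v(m τ, x)|^p` of a field `v` (with `v m x` the value at
time `m τ`), as an extended real number; an infinite moment has logarithm `⊤`. -/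
noncomputable def upperLyapunov {Ω : Type*} [MeasurableSpace Ω] (P : Measure Ω) (τ : ℝ)
    (v : ℕ → ℝ → Ω → ℝ) (p : ℝ) (x : ℝ) : EReal :=
  limsup (fun m : ℕ => ENNReal.log (∫⁻ ω, ‖v m x ω‖ₑ ^ p ∂P) / (((m : ℝ) * τ : ℝ) : EReal)) atTop

/-- Weak intermittency: for all `x ∈ [0, 1]`, the second exponent is positive and the `p`-th
one is finite for `p > 2`. -/
def WeaklyIntermittent {Ω : Type*} [MeasurableSpace Ω] (P : Measure Ω) (τ : ℝ)
    (v : ℕ → ℝ → Ω → ℝ) : Prop :=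
  ∀ x ∈ Set.Icc (0 : ℝ) 1,
    0 < upperLyapunov P τ v 2 x ∧ ∀ p : ℝ, 2 < p → upperLyapunov P τ v p x < ⊤

/-- The conditions on the step sizes `1 / n` and `τ`; there is none for `θ > 1 / 2`. -/
def StepSizeCondition (θ : ℝ) (n : ℕ) (τ : ℝ) : Prop :=
  (θ < 1 / 2 → ∃ r : ℝ, 0 < r ∧ (n : ℝ) ^ 2 * τ ≤ r ∧ r < 1 / (2 - 4 * θ)) ∧
  (θ = 1 / 2 → ∃ ε : ℝ, 0 < ε ∧ ε < 1 / 2 ∧ (n : ℝ) ^ 2 * τ ≤ 1 / ε - 1 / 2)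

/-- `I₀ = inf_{x ∈ [0, 1]} u₀(x)`. -/
noncomputable def infInitial (u₀ : ℝ → ℝ) : ℝ := ⨅ x : Set.Icc (0 : ℝ) 1, u₀ x

/-- `J₀ = inf_{x ≠ 0} |σ(x) / x|`. -/
noncomputable def infSlope (σ : ℝ → ℝ) : ℝ := ⨅ x : {x : ℝ // x ≠ 0}, |σ x / x|

end ThetaScheme

/-!
The scheme is linear up to the noise and translation invariant in space, so it is diagonalised by
the characters of `ℤ / n`: with `λ_l ≤ 0` the eigenvalues of the periodic discrete Laplacian, one
step multiplies the `l`-th mode by `(1 + (1 - θ) τ λ_l) / (1 - θ τ λ_l)` (`stepSymbol`) and smooths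
the noise by `1 / (1 - θ τ λ_l)` (`resolventSymbol`); see `scheme_iff`. The solution is thus almost
surely an explicit continuous function of the sheet increments (`IsSolution.ae_eq_noisePath`), which
are independent normal variables (`IsBrownianSheet.isStandardNoise`). Fourier multipliers are
self-adjoint, so a linear functional `c` of the solution at one time level is, given the preceding
level, normal with mean the functional `mult stepSymbol c` and an explicit variance
(`IsStandardNoise.lintegral_noisePath_succ`). Everything below iterates this fact.

*Upper bound.* If `Z` is normal with variance `v`, then `E |x + Z|^p ≤ (x² + 8 p v)^(p/2)`
(`lintegral_abs_add_rpow_gaussianReal_le`). Together with Minkowski's inequality in `L^(p/2)` this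
yields a Burkholder-type estimate with the optimal constant of order `√p`, and hence a renewal
inequality for the squared `L^p` norms at the grid points (`sqNorm_le_duhamel`). Its kernel,
discounted at rate `β`, has total mass at most `3 / β + 12 / √β`, uniformly in `n` and `τ`
(`tau_mul_sum_kernel_sq_le`): the damping rate of the `l`-th mode, relative to its squared
smoothing factor, is at least `2 n² sin² (2 π l / n)`, uniformly up to the boundary of the stability
region, because the factor that degenerates there does so only at the highest frequencies. So the
squared norms grow at most like `exp (β t)` once `λ² L² p (3 / β + 12 / √β)` is small, and taking
`√β` proportional to `p λ² L²` bounds the exponent `β p / 2` by a multiple of `L⁴ λ⁴ p³`. When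
`L = 0` every `β > 0` is admissible.

*Lower bound.* The zero Fourier mode is a martingale. By the Cauchy-Schwarz inequality and
`|σ(x)| ≥ J₀ |x|`, its second moment gains at least the factor `1 + λ² J₀² τ` in each step
(`le_secondMoment_mean`). The other modes are strictly damped, so after a fixed number of steps the
noise at every grid point contributes to every averaging functional, in particular to the value at
an interpolated point; this transfers the growth to all `x` (`exists_le_secondMoment`).
-/

namespace ThetaScheme

open scoped Topology

/-! ### Moments of shifted Gaussian variables -/

lemma abs_one_add_rpow_add_abs_one_sub_rpow_le_of_nonneg {p y : ℝ} (hp : 2 ≤ p) (hy : 0 ≤ y) :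
    |1 + y| ^ p + |1 - y| ^ p ≤ Real.exp (p * y) + Real.exp (-(p * y)) := by
  have hp0 : 0 ≤ p := by linarith
  rcases le_total y 1 with h1 | h1
  · have h2 : |1 + y| ^ p ≤ Real.exp (p * y) := by
      rw [mul_comm, Real.exp_mul, abs_of_nonneg (by linarith)]
      exact Real.rpow_le_rpow (by linarith) (by linarith [Real.add_one_le_exp y]) hp0
    have h3 : |1 - y| ^ p ≤ Real.exp (-(p * y)) := by
      rw [mul_comm, ← neg_mul, Real.exp_mul, abs_of_nonneg (by linarith)]
      exact Real.rpow_le_rpow (by linarith) (by linarith [Real.add_one_le_exp (-y)]) hp0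
    exact add_le_add h2 h3
  · -- superadditivity of `t ↦ t ^ (p / 2)` reduces this case to `2 + 2 y² ≤ exp (2 y)`
    have key : (|1 + y| ^ 2) ^ (p / 2) + (|1 - y| ^ 2) ^ (p / 2)
        ≤ (|1 + y| ^ 2 + |1 - y| ^ 2) ^ (p / 2) :=
      Real.add_rpow_le_rpow_add (by positivity) (by positivity) (by linarith)
    have conv : ∀ t : ℝ, 0 ≤ t → (t ^ 2) ^ (p / 2) = t ^ p := fun t ht => by
      rw [← Real.rpow_natCast, ← Real.rpow_mul ht]; congr 1; push_cast; ring
    rw [conv _ (abs_nonneg _), conv _ (abs_nonneg _)] at key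
    have h2 : |1 + y| ^ 2 + |1 - y| ^ 2 ≤ Real.exp (2 * y) := by
      rw [sq_abs, sq_abs]
      have := Real.quadratic_le_exp_of_nonneg (x := 2 * y) (by linarith)
      nlinarith
    have h3 : (|1 + y| ^ 2 + |1 - y| ^ 2) ^ (p / 2) ≤ Real.exp (p * y) := by
      have : Real.exp (p * y) = Real.exp (2 * y) ^ (p / 2) := by
        rw [← Real.exp_mul]; congr 1; ring
      rw [this]
      exact Real.rpow_le_rpow (by positivity) h2 (by linarith)
    linarith [Real.exp_pos (-(p * y))]

lemma abs_one_add_rpow_add_abs_one_sub_rpow_le {p : ℝ} (hp : 2 ≤ p) (y : ℝ) :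
    |1 + y| ^ p + |1 - y| ^ p ≤ Real.exp (p * y) + Real.exp (-(p * y)) := by
  rcases le_total 0 y with h | h
  · exact abs_one_add_rpow_add_abs_one_sub_rpow_le_of_nonneg hp h
  · have := abs_one_add_rpow_add_abs_one_sub_rpow_le_of_nonneg hp (neg_nonneg.2 h)
    simp only [sub_neg_eq_add, mul_neg, neg_neg, ← sub_eq_add_neg] at this
    linarith

lemma lintegral_exp_mul_gaussianReal (v : ℝ≥0) (b : ℝ) :
    ∫⁻ z, ENNReal.ofReal (Real.exp (b * z)) ∂(gaussianReal 0 v)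
      = ENNReal.ofReal (Real.exp (b ^ 2 * v / 2)) := by
  rw [← ofReal_integral_eq_lintegral_ofReal (integrable_exp_mul_gaussianReal b)
    (ae_of_all _ fun z => (Real.exp_pos _).le)]
  have h := congrFun (mgf_id_gaussianReal (μ := 0) (v := v)) b
  simp only [mgf, id] at h
  rw [h]; congr 2; ring

lemma lintegral_comp_neg_gaussianReal (v : ℝ≥0) {f : ℝ → ℝ≥0∞} (hf : Measurable f) :
    ∫⁻ z, f (-z) ∂(gaussianReal 0 v) = ∫⁻ z, f z ∂(gaussianReal 0 v) := by
  conv_rhs => rw [← neg_zero (G := ℝ), ← gaussianReal_map_neg (μ := 0) (v := v),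
    lintegral_map hf measurable_neg]

/-- Small variance: symmetrising in `z` removes the term of first order, and `|1 + y| ^ p` is
compared with `exp (p y)`. -/
lemma lintegral_abs_add_rpow_gaussianReal_le_of_small {p x : ℝ} {v : ℝ≥0} (hp : 2 ≤ p)
    (hx : x ≠ 0) (hv : p * v ≤ x ^ 2) :
    ∫⁻ z, ENNReal.ofReal (|x + z| ^ p) ∂(gaussianReal 0 v)
      ≤ ENNReal.ofReal ((x ^ 2 + 8 * p * v) ^ (p / 2)) := by
  have hx2 : 0 < x ^ 2 := by positivity
  have hp0 : 0 < p := by linarith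
  have conv : ∀ t : ℝ, (t ^ 2) ^ (p / 2) = |t| ^ p := fun t => by
    rw [← sq_abs, ← Real.rpow_natCast, ← Real.rpow_mul (abs_nonneg t)]; congr 1; push_cast; ring
  have hpt : ∀ z : ℝ, |x + z| ^ p + |x + -z| ^ p
      ≤ |x| ^ p * (Real.exp ((p / x) * z) + Real.exp ((-(p / x)) * z)) := fun z => by
    have h := abs_one_add_rpow_add_abs_one_sub_rpow_le hp (z / x)
    have e1 : |x + z| = |x| * |1 + z / x| := by rw [← abs_mul]; congr 1; field_simp
    have e2 : |x + -z| = |x| * |1 - z / x| := by rw [← abs_mul]; congr 1; field_simp; ring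
    rw [e1, e2, Real.mul_rpow (abs_nonneg _) (abs_nonneg _),
      Real.mul_rpow (abs_nonneg _) (abs_nonneg _), ← mul_add]
    refine mul_le_mul_of_nonneg_left (h.trans_eq ?_) (by positivity)
    congr 2 <;> ring
  have hm : Measurable fun z : ℝ => ENNReal.ofReal (|x + z| ^ p) := by fun_prop
  have h2 : 2 * ∫⁻ z, ENNReal.ofReal (|x + z| ^ p) ∂(gaussianReal 0 v)
      ≤ 2 * (ENNReal.ofReal (|x| ^ p * Real.exp (p ^ 2 * v / x ^ 2 / 2))) := by
    calc 2 * ∫⁻ z, ENNReal.ofReal (|x + z| ^ p) ∂(gaussianReal 0 v)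
        = ∫⁻ z, ENNReal.ofReal (|x + z| ^ p) + ENNReal.ofReal (|x + -z| ^ p)
            ∂(gaussianReal 0 v) := by
          rw [lintegral_add_left hm, lintegral_comp_neg_gaussianReal v hm, two_mul]
      _ ≤ ∫⁻ z, ENNReal.ofReal (|x| ^ p) * (ENNReal.ofReal (Real.exp ((p / x) * z))
            + ENNReal.ofReal (Real.exp ((-(p / x)) * z))) ∂(gaussianReal 0 v) := by
          refine lintegral_mono fun z => ?_
          rw [← ENNReal.ofReal_add (by positivity) (by positivity),
            ← ENNReal.ofReal_add (by positivity) (by positivity),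
            ← ENNReal.ofReal_mul (by positivity)]
          exact ENNReal.ofReal_le_ofReal (hpt z)
      _ = _ := by
          rw [lintegral_const_mul _ (by fun_prop), lintegral_add_left (by fun_prop),
            lintegral_exp_mul_gaussianReal, lintegral_exp_mul_gaussianReal,
            ENNReal.ofReal_mul (by positivity), neg_sq, ← two_mul, mul_left_comm]
          congr 5
          field_simp
  have h3 := (ENNReal.mul_le_mul_iff_right (by norm_num) (by norm_num)).1 h2
  refine h3.trans (ENNReal.ofReal_le_ofReal ?_)
  set s : ℝ := p * v / x ^ 2 with hs
  have hs0 : 0 ≤ s := by positivity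
  have hs1 : s ≤ 1 := by rw [hs, div_le_one hx2]; exact hv
  have he : Real.exp s ≤ 1 + 8 * s := by
    have := Real.abs_exp_sub_one_sub_id_le (x := s) (by rw [abs_of_nonneg hs0]; exact hs1)
    have := (abs_le.1 this).2
    nlinarith
  have e1 : Real.exp (p ^ 2 * v / x ^ 2 / 2) = Real.exp s ^ (p / 2) := by
    rw [← Real.exp_mul, hs]; congr 1; field_simp
  have e2 : x ^ 2 + 8 * p * v = x ^ 2 * (1 + 8 * s) := by rw [hs]; field_simp
  rw [e1, e2, Real.mul_rpow (by positivity) (by positivity), conv]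
  exact mul_le_mul_of_nonneg_left (Real.rpow_le_rpow (Real.exp_pos _).le he (by linarith))
    (by positivity)

/-- Large variance: with `S = √(p v)`, the power `(|x + z| / S) ^ p` is bounded by
`exp (p |z| / S)`. -/
lemma lintegral_abs_add_rpow_gaussianReal_le_of_large {p x : ℝ} {v : ℝ≥0} (hp : 2 ≤ p)
    (hv0 : 0 < v) (hv : x ^ 2 ≤ p * v) :
    ∫⁻ z, ENNReal.ofReal (|x + z| ^ p) ∂(gaussianReal 0 v)
      ≤ ENNReal.ofReal ((x ^ 2 + 8 * p * v) ^ (p / 2)) := by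
  have hp0 : 0 < p := by linarith
  have hv0' : (0 : ℝ) < v := hv0
  set S : ℝ := √(p * v) with hS
  have hS0 : 0 < S := Real.sqrt_pos.2 (by positivity)
  have hS2 : S ^ 2 = p * v := Real.sq_sqrt (by positivity)
  have hxS : |x| ≤ S := Real.abs_le_sqrt hv
  have hpt : ∀ z : ℝ, |x + z| ^ p
      ≤ S ^ p * (Real.exp ((p / S) * z) + Real.exp ((-(p / S)) * z)) := fun z => by
    have h1 : |x + z| / S ≤ Real.exp (|z| / S) := by
      have h2 : |x + z| / S ≤ |z| / S + 1 := by
        rw [div_add_one hS0.ne']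
        exact div_le_div_of_nonneg_right (by linarith [abs_add_le x z]) hS0.le
      exact h2.trans (Real.add_one_le_exp _)
    have h2 : |x + z| ^ p ≤ S ^ p * Real.exp (p / S * |z|) := by
      have : |x + z| ≤ S * Real.exp (|z| / S) := by rwa [div_le_iff₀' hS0] at h1
      calc |x + z| ^ p ≤ (S * Real.exp (|z| / S)) ^ p :=
            Real.rpow_le_rpow (abs_nonneg _) this hp0.le
        _ = S ^ p * Real.exp (p / S * |z|) := by
            rw [Real.mul_rpow hS0.le (Real.exp_pos _).le, ← Real.exp_mul]
            congr 2; ring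
    refine h2.trans (mul_le_mul_of_nonneg_left ?_ (by positivity))
    rcases abs_cases z with ⟨h, -⟩ | ⟨h, -⟩ <;> rw [h]
    · linarith [Real.exp_pos (-(p / S) * z)]
    · rw [mul_neg, ← neg_mul]; linarith [Real.exp_pos (p / S * z)]
  calc ∫⁻ z, ENNReal.ofReal (|x + z| ^ p) ∂(gaussianReal 0 v)
      ≤ ∫⁻ z, ENNReal.ofReal (S ^ p) * (ENNReal.ofReal (Real.exp ((p / S) * z))
            + ENNReal.ofReal (Real.exp ((-(p / S)) * z))) ∂(gaussianReal 0 v) := by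
        refine lintegral_mono fun z => ?_
        rw [← ENNReal.ofReal_add (by positivity) (by positivity),
          ← ENNReal.ofReal_mul (by positivity)]
        exact ENNReal.ofReal_le_ofReal (hpt z)
    _ = ENNReal.ofReal (S ^ p * (2 * Real.exp (p / 2))) := by
        rw [lintegral_const_mul _ (by fun_prop), lintegral_add_left (by fun_prop),
          lintegral_exp_mul_gaussianReal, lintegral_exp_mul_gaussianReal,
          ENNReal.ofReal_mul (by positivity), neg_sq,
          ← ENNReal.ofReal_add (by positivity) (by positivity), ← two_mul]
        have : (p / S) ^ 2 * v / 2 = p / 2 := by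
          rw [div_pow, hS2]; field_simp
        rw [this]
    _ ≤ _ := by
        refine ENNReal.ofReal_le_ofReal ?_
        have h1 : (8 * S ^ 2) ^ (p / 2) ≤ (x ^ 2 + 8 * p * v) ^ (p / 2) :=
          Real.rpow_le_rpow (by positivity) (by rw [hS2]; nlinarith [sq_nonneg x]) (by linarith)
        refine le_trans ?_ h1
        have h2 : (S ^ 2) ^ (p / 2) = S ^ p := by
          rw [← Real.rpow_natCast, ← Real.rpow_mul hS0.le]; congr 1; push_cast; ring
        rw [Real.mul_rpow (by norm_num) (by positivity), h2, mul_comm]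
        refine mul_le_mul_of_nonneg_right ?_ (by positivity)
        -- `2 exp (p / 2) ≤ exp (p / 2) ^ 2 = (e ^ 2) ^ (p / 2)`, and `e ^ 2 < 8`
        have h3 : (2 : ℝ) ≤ Real.exp (p / 2) := by linarith [Real.add_one_le_exp (p / 2)]
        have h4 : Real.exp (p / 2) * Real.exp (p / 2) = (Real.exp 1 ^ 2) ^ (p / 2) := by
          rw [← Real.exp_add, ← Real.exp_nat_mul, ← Real.exp_mul]; congr 1; push_cast; ring
        have h5 : (Real.exp 1 ^ 2) ^ (p / 2) ≤ (8 : ℝ) ^ (p / 2) :=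
          Real.rpow_le_rpow (by positivity)
            (by nlinarith [Real.exp_one_lt_d9, Real.exp_pos 1]) (by linarith)
        nlinarith [Real.exp_pos (p / 2)]

/-- Hypercontractive-type estimate with the optimal growth `√p` of the Gaussian moments; the
coefficient one in front of `x ^ 2` is what lets the estimate be iterated in time. -/
lemma lintegral_abs_add_rpow_gaussianReal_le {p : ℝ} (hp : 2 ≤ p) (x : ℝ) (v : ℝ≥0) :
    ∫⁻ z, ENNReal.ofReal (|x + z| ^ p) ∂(gaussianReal 0 v)
      ≤ ENNReal.ofReal ((x ^ 2 + 8 * p * v) ^ (p / 2)) := by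
  rcases eq_or_lt_of_le (zero_le (a := v)) with rfl | hv0
  · have conv : (x ^ 2) ^ (p / 2) = |x| ^ p := by
      rw [← sq_abs, ← Real.rpow_natCast, ← Real.rpow_mul (abs_nonneg x)]
      congr 1; push_cast; ring
    rw [gaussianReal_zero_var, lintegral_dirac]
    simp [conv]
  · rcases le_total (p * v) (x ^ 2) with h | h
    · refine lintegral_abs_add_rpow_gaussianReal_le_of_small hp (fun hx => ?_) h
      have : (0 : ℝ) < v := hv0
      rw [hx] at h
      nlinarith
    · exact lintegral_abs_add_rpow_gaussianReal_le_of_large hp hv0 h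

lemma lintegral_add_sq_gaussianReal (x : ℝ) (v : ℝ≥0) :
    ∫⁻ z, ENNReal.ofReal ((x + z) ^ 2) ∂(gaussianReal 0 v) = ENNReal.ofReal (x ^ 2 + v) := by
  have hm : MemLp id 2 (gaussianReal 0 v) := memLp_id_gaussianReal 2
  have hi : Integrable id (gaussianReal 0 v) := hm.integrable (by norm_num)
  have hsq : Integrable (fun z : ℝ => z ^ 2) (gaussianReal 0 v) := hm.integrable_sq
  have h1 : Integrable (fun z : ℝ => (x + z) ^ 2) (gaussianReal 0 v) := by
    have := ((integrable_const (x ^ 2)).add (hi.const_mul (2 * x))).add hsq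
    refine this.congr (ae_of_all _ fun z => ?_)
    simp; ring
  rw [← ofReal_integral_eq_lintegral_ofReal h1 (ae_of_all _ fun z => sq_nonneg _)]
  congr 1
  have h2 : ∫ z, z ^ 2 ∂(gaussianReal 0 v) = v := by
    have := variance_fun_id_gaussianReal (μ := 0) (v := v)
    rwa [variance_eq_integral (by fun_prop), integral_id_gaussianReal,
      show (fun z : ℝ => (z - 0) ^ 2) = fun z => z ^ 2 by simp] at this
  calc ∫ z, (x + z) ^ 2 ∂(gaussianReal 0 v)
      = ∫ z, (x ^ 2 + 2 * x * z) + z ^ 2 ∂(gaussianReal 0 v) := by congr 1; ext z; ring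
    _ = x ^ 2 + v := by
      have h3 : Integrable (fun z : ℝ => 2 * x * z) (gaussianReal 0 v) := hi.const_mul (2 * x)
      have h4 : Integrable (fun z : ℝ => x ^ 2 + 2 * x * z) (gaussianReal 0 v) :=
        (integrable_const _).add h3
      rw [integral_add h4 hsq,
        integral_add (integrable_const _) h3, h2, integral_const_mul]
      simp

/-! ### Fourier multipliers on the cyclic group -/

section Fourier

variable {n : ℕ} [NeZero n]

/-- The real part `cos (2 π j / n)` of the standard character of `ℤ / n`. -/
noncomputable def cosChar (j : ZMod n) : ℝ := (ZMod.stdAddChar j : ℂ).re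

/-- The convolution kernel on `ℤ / n` of the Fourier multiplier with symbol `f`. -/
noncomputable def kernel (f : ZMod n → ℝ) (x : ZMod n) : ℝ :=
  (n : ℝ)⁻¹ * ∑ l, f l * cosChar (l * x)

/-- The Fourier multiplier on `ℤ / n` with symbol `f`. It is used for even `f` only, which is why
the real kernel suffices. -/
noncomputable def mult (f v : ZMod n → ℝ) (j : ZMod n) : ℝ :=
  ∑ k, kernel f (j - k) * v k

lemma conj_stdAddChar (j : ZMod n) :
    (starRingEnd ℂ) (ZMod.stdAddChar j : ℂ) = ZMod.stdAddChar (-j) := by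
  rw [ZMod.stdAddChar_apply, ZMod.stdAddChar_apply, AddChar.map_neg_eq_inv, Circle.coe_inv_eq_conj]

lemma cosChar_neg (j : ZMod n) : cosChar (-j) = cosChar j := by
  rw [cosChar, ← conj_stdAddChar, Complex.conj_re, cosChar]

lemma cosChar_zero : cosChar (0 : ZMod n) = 1 := by simp [cosChar]

lemma normSq_stdAddChar (j : ZMod n) : Complex.normSq (ZMod.stdAddChar j : ℂ) = 1 := by
  rw [ZMod.stdAddChar_apply]; simp

lemma abs_cosChar_le_one (j : ZMod n) : |cosChar j| ≤ 1 := by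
  have h := Complex.abs_re_le_norm (ZMod.stdAddChar j : ℂ)
  rwa [ZMod.stdAddChar_apply, Circle.norm_coe] at h

lemma cosChar_eq_one_iff {j : ZMod n} : cosChar j = 1 ↔ j = 0 := by
  refine ⟨fun h => ?_, fun h => by rw [h, cosChar_zero]⟩
  have h1 := normSq_stdAddChar j
  rw [Complex.normSq_apply] at h1
  rw [cosChar] at h
  have h2 : (ZMod.stdAddChar j : ℂ).im = 0 := by
    rw [h] at h1; nlinarith
  apply ZMod.injective_stdAddChar
  rw [AddChar.map_zero_eq_one]
  exact Complex.ext (by simpa using h) (by simpa using h2)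

lemma cosChar_eq_cos (j : ZMod n) : cosChar j = Real.cos (2 * Real.pi * j.val / n) := by
  have h : (ZMod.stdAddChar j : ℂ) = Complex.exp ((2 * Real.pi * j.val / n : ℝ) * Complex.I) := by
    conv_lhs => rw [← ZMod.natCast_zmod_val j]
    have := ZMod.stdAddChar_coe (N := n) (j.val : ℤ)
    rw [Int.cast_natCast] at this
    rw [this]
    congr 1; push_cast; ring
  rw [cosChar, h, Complex.exp_ofReal_mul_I_re]

lemma kernel_neg (f : ZMod n → ℝ) (x : ZMod n) : kernel f (-x) = kernel f x := by
  simp [kernel, cosChar_neg]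

/-- For an even symbol the imaginary parts cancel, so the real kernel is the complex one. -/
lemma kernel_coe {f : ZMod n → ℝ} (hf : Function.Even f) (x : ZMod n) :
    ((kernel f x : ℝ) : ℂ) = (n : ℂ)⁻¹ * ∑ l, (f l : ℂ) * ZMod.stdAddChar (l * x) := by
  have h1 : ∑ l, (f l : ℂ) * ZMod.stdAddChar (l * x)
      = ∑ l, (f l : ℂ) * ZMod.stdAddChar (-(l * x)) := by
    refine (Fintype.sum_equiv (Equiv.neg _) _ _ fun l => ?_)
    simp [hf l]
  have h2 : ∑ l, (f l : ℂ) * ZMod.stdAddChar (l * x)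
      = ((∑ l, f l * cosChar (l * x) : ℝ) : ℂ) := by
    have h3 : 2 * ∑ l, (f l : ℂ) * ZMod.stdAddChar (l * x)
        = 2 * ((∑ l, f l * cosChar (l * x) : ℝ) : ℂ) := by
      rw [two_mul]
      nth_rw 2 [h1]
      rw [← Finset.sum_add_distrib, Complex.ofReal_sum, Finset.mul_sum]
      refine Finset.sum_congr rfl fun l _ => ?_
      rw [← mul_add, ← conj_stdAddChar, Complex.add_conj, cosChar]
      push_cast; ring
    exact mul_left_cancel₀ two_ne_zero h3
  rw [h2, kernel]; push_cast; rfl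

lemma sum_stdAddChar_mul (b : ZMod n) :
    ∑ k : ZMod n, (ZMod.stdAddChar (k * b) : ℂ) = if b = 0 then (n : ℂ) else 0 := by
  have := AddChar.sum_mulShift b (ZMod.isPrimitive_stdAddChar n)
  rw [this, ZMod.card]
  split_ifs <;> simp

/-- Convolving kernels multiplies symbols. -/
lemma sum_kernel_mul_kernel {f g : ZMod n → ℝ} (hf : Function.Even f) (hg : Function.Even g)
    (j i : ZMod n) :
    ∑ k, kernel f (j - k) * kernel g (k - i) = kernel (f * g) (j - i) := by
  have hfg : Function.Even (f * g) := fun l => by simp [hf l, hg l]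
  have hn : (n : ℂ) ≠ 0 := Nat.cast_ne_zero.2 (NeZero.ne n)
  apply Complex.ofReal_injective
  rw [kernel_coe hfg, Complex.ofReal_sum]
  have e : ∀ k l m : ZMod n, (ZMod.stdAddChar (l * (j - k)) : ℂ) * ZMod.stdAddChar (m * (k - i))
      = ZMod.stdAddChar (l * j - m * i) * ZMod.stdAddChar (k * (m - l)) := fun k l m => by
    rw [← AddChar.map_add_eq_mul, ← AddChar.map_add_eq_mul]; congr 1; ring
  calc ∑ k, ((kernel f (j - k) * kernel g (k - i) : ℝ) : ℂ)
      = ∑ k, ∑ l, ∑ m, (n : ℂ)⁻¹ * (n : ℂ)⁻¹ * (f l * g m * ZMod.stdAddChar (l * j - m * i))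
          * ZMod.stdAddChar (k * (m - l)) := by
        refine Finset.sum_congr rfl fun k _ => ?_
        rw [Complex.ofReal_mul, kernel_coe hf, kernel_coe hg, mul_mul_mul_comm,
          Finset.sum_mul_sum, Finset.mul_sum]
        refine Finset.sum_congr rfl fun l _ => ?_
        rw [Finset.mul_sum]
        refine Finset.sum_congr rfl fun m _ => ?_
        rw [mul_mul_mul_comm (f l : ℂ), e]
        ring
    _ = ∑ l, ∑ m, (n : ℂ)⁻¹ * (n : ℂ)⁻¹ * (f l * g m * ZMod.stdAddChar (l * j - m * i))
          * if m = l then (n : ℂ) else 0 := by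
        rw [Finset.sum_comm]
        refine Finset.sum_congr rfl fun l _ => ?_
        rw [Finset.sum_comm]
        refine Finset.sum_congr rfl fun m _ => ?_
        rw [← Finset.mul_sum, sum_stdAddChar_mul]
        simp only [sub_eq_zero]
    _ = _ := by
        rw [Finset.mul_sum]
        refine Finset.sum_congr rfl fun l _ => ?_
        simp only [mul_ite, mul_zero, Finset.sum_ite_eq', Finset.mem_univ, if_true]
        rw [← mul_sub, Pi.mul_apply]
        push_cast
        field_simp

lemma kernel_one (x : ZMod n) : kernel (1 : ZMod n → ℝ) x = if x = 0 then 1 else 0 := by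
  have hn : (n : ℂ) ≠ 0 := Nat.cast_ne_zero.2 (NeZero.ne n)
  apply Complex.ofReal_injective
  rw [kernel_coe (fun _ => rfl)]
  simp only [Pi.one_apply, Complex.ofReal_one, one_mul, sum_stdAddChar_mul]
  split_ifs <;> simp [hn]

lemma mult_one (v : ZMod n → ℝ) : mult 1 v = v := by
  ext j
  simp [mult, kernel_one, sub_eq_zero]

lemma mult_mult {f g : ZMod n → ℝ} (hf : Function.Even f) (hg : Function.Even g)
    (v : ZMod n → ℝ) : mult f (mult g v) = mult (f * g) v := by
  ext j
  simp only [mult, Finset.mul_sum]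
  rw [Finset.sum_comm]
  refine Finset.sum_congr rfl fun i _ => ?_
  rw [← sum_kernel_mul_kernel hf hg, Finset.sum_mul]
  exact Finset.sum_congr rfl fun k _ => by ring

lemma kernel_add (f g : ZMod n → ℝ) (x : ZMod n) : kernel (f + g) x = kernel f x + kernel g x := by
  simp [kernel, add_mul, Finset.sum_add_distrib, mul_add]

lemma kernel_smul (a : ℝ) (f : ZMod n → ℝ) (x : ZMod n) : kernel (a • f) x = a * kernel f x := by
  simp only [kernel, Pi.smul_apply, smul_eq_mul, mul_assoc, ← Finset.mul_sum]
  ring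

lemma mult_add_left (f g v : ZMod n → ℝ) : mult (f + g) v = mult f v + mult g v := by
  ext j; simp [mult, kernel_add, add_mul, Finset.sum_add_distrib]

lemma mult_smul_left (a : ℝ) (f v : ZMod n → ℝ) : mult (a • f) v = a • mult f v := by
  ext j; simp [mult, kernel_smul, mul_assoc, Finset.mul_sum]

lemma mult_add_right (f v w : ZMod n → ℝ) : mult f (v + w) = mult f v + mult f w := by
  ext j; simp [mult, mul_add, Finset.sum_add_distrib]

/-- Fourier multipliers are self-adjoint. -/
lemma dotProduct_mult (f c v : ZMod n → ℝ) : c ⬝ᵥ mult f v = mult f c ⬝ᵥ v := by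
  simp only [dotProduct, mult, Finset.mul_sum, Finset.sum_mul]
  rw [Finset.sum_comm]
  refine Finset.sum_congr rfl fun k _ => Finset.sum_congr rfl fun j _ => ?_
  rw [← kernel_neg, neg_sub]; ring

lemma mult_single (f : ZMod n → ℝ) (j k : ZMod n) :
    mult f (Pi.single j 1) k = kernel f (k - j) := by
  simp [mult, Pi.single_apply]

lemma mult_const {f : ZMod n → ℝ} (hf : Function.Even f) (a : ℝ) (j : ZMod n) :
    mult f (fun _ => a) j = f 0 * a := by
  have hn : (n : ℂ) ≠ 0 := Nat.cast_ne_zero.2 (NeZero.ne n)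
  rw [mult, ← Finset.sum_mul]
  congr 1
  apply Complex.ofReal_injective
  rw [Complex.ofReal_sum]
  have e : ∀ k l : ZMod n, (ZMod.stdAddChar (l * (j - k)) : ℂ)
      = ZMod.stdAddChar (l * j) * ZMod.stdAddChar (k * (-l)) := fun k l => by
    rw [← AddChar.map_add_eq_mul]; congr 1; ring
  simp only [kernel_coe hf]
  rw [← Finset.mul_sum, Finset.sum_comm]
  simp only [e, ← mul_assoc, ← Finset.mul_sum, sum_stdAddChar_mul, neg_eq_zero]
  simp [mul_comm, hn]

/-- The `ℓ²` norm of a kernel, by Parseval. -/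
lemma sum_kernel_sq {f : ZMod n → ℝ} (hf : Function.Even f) (j : ZMod n) :
    ∑ k, kernel f (k - j) ^ 2 = (n : ℝ)⁻¹ * ∑ l, f l ^ 2 := by
  have h := sum_kernel_mul_kernel hf hf j j
  rw [sub_self] at h
  rw [show (n : ℝ)⁻¹ * ∑ l, f l ^ 2 = kernel (f * f) 0 by simp [kernel, cosChar_zero, sq], ← h]
  refine Finset.sum_congr rfl fun k _ => ?_
  rw [← kernel_neg f (j - k), neg_sub, sq]

lemma abs_kernel_le_one {f : ZMod n → ℝ} (hf : ∀ l, |f l| ≤ 1) (x : ZMod n) :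
    |kernel f x| ≤ 1 := by
  have hn : (0 : ℝ) < n := Nat.cast_pos.2 (NeZero.pos n)
  rw [kernel, abs_mul, abs_of_nonneg (by positivity), inv_mul_le_iff₀ hn]
  refine (Finset.abs_sum_le_sum_abs _ _).trans ?_
  have : ∑ l : ZMod n, |f l * cosChar (l * x)| ≤ ∑ l : ZMod n, (1 : ℝ) :=
    Finset.sum_le_sum fun l _ => by
      rw [abs_mul]; exact mul_le_one₀ (hf l) (abs_nonneg _) (abs_cosChar_le_one _)
  simpa using this

lemma abs_mult_le {f : ZMod n → ℝ} (hf : ∀ l, |f l| ≤ 1) (v : ZMod n → ℝ) (j : ZMod n) :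
    |mult f v j| ≤ ∑ k, |v k| := by
  refine (Finset.abs_sum_le_sum_abs _ _).trans (Finset.sum_le_sum fun k _ => ?_)
  rw [abs_mul]
  exact mul_le_of_le_one_left (abs_nonneg _) (abs_kernel_le_one hf _)

/-- The symbol of the discrete Laplacian. -/
noncomputable def lapSymbol (n : ℕ) [NeZero n] (l : ZMod n) : ℝ :=
  (n : ℝ) ^ 2 * (2 * cosChar l - 2)

lemma lapSymbol_even : Function.Even (lapSymbol n) := fun l => by
  simp [lapSymbol, cosChar_neg]

lemma cosChar_add_add_cosChar_sub (a b : ZMod n) :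
    cosChar (a + b) + cosChar (a - b) = 2 * cosChar a * cosChar b := by
  simp only [cosChar, sub_eq_add_neg, AddChar.map_add_eq_mul, ← conj_stdAddChar b, Complex.mul_re,
    Complex.conj_re, Complex.conj_im]
  ring

lemma discreteLaplacian_kernel (f : ZMod n → ℝ) (x : ZMod n) :
    discreteLaplacian n (kernel f) x = kernel (lapSymbol n * f) x := by
  simp only [discreteLaplacian, kernel, Pi.mul_apply, lapSymbol]
  have : ∀ l : ZMod n, (n : ℝ) ^ 2 * (2 * cosChar l - 2) * f l * cosChar (l * x)
      = (n : ℝ) ^ 2 * (f l * cosChar (l * (x + 1)) - 2 * (f l * cosChar (l * x))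
        + f l * cosChar (l * (x - 1))) := fun l => by
    have h := cosChar_add_add_cosChar_sub (l * x) l
    rw [show l * (x + 1) = l * x + l by ring, show l * (x - 1) = l * x - l by ring]
    linear_combination (-(n : ℝ) ^ 2 * f l) * h
  simp only [this]
  rw [← Finset.mul_sum, Finset.sum_add_distrib, Finset.sum_sub_distrib, ← Finset.mul_sum]
  ring

lemma discreteLaplacian_mult (f v : ZMod n → ℝ) :
    discreteLaplacian n (mult f v) = mult (lapSymbol n * f) v := by
  ext j
  have : ∀ k, kernel (lapSymbol n * f) (j - k) * v k = (n : ℝ) ^ 2 *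
      (kernel f (j + 1 - k) * v k - 2 * (kernel f (j - k) * v k) + kernel f (j - 1 - k) * v k) :=
    fun k => by
      rw [← discreteLaplacian_kernel, discreteLaplacian,
        show j - k + 1 = j + 1 - k by ring, show j - k - 1 = j - 1 - k by ring]
      ring
  simp only [discreteLaplacian, mult, this]
  rw [← Finset.mul_sum, Finset.sum_add_distrib, Finset.sum_sub_distrib, ← Finset.mul_sum]

lemma discreteLaplacian_eq_mult (v : ZMod n → ℝ) :
    discreteLaplacian n v = mult (lapSymbol n) v := by
  conv_lhs => rw [← mult_one v]
  rw [discreteLaplacian_mult, mul_one]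

end Fourier

/-! ### Symbols of the scheme and bounds for the discrete heat kernel -/

section Symbols

variable {n : ℕ} [NeZero n]

/-- The symbol of `(1 - θ τ Δ)⁻¹`. -/
noncomputable def resolventSymbol (n : ℕ) [NeZero n] (θ τ : ℝ) (l : ZMod n) : ℝ :=
  (1 - θ * τ * lapSymbol n l)⁻¹

/-- The symbol of the one-step propagator `(1 - θ τ Δ)⁻¹ (1 + (1 - θ) τ Δ)`. -/
noncomputable def stepSymbol (n : ℕ) [NeZero n] (θ τ : ℝ) (l : ZMod n) : ℝ :=
  (1 + (1 - θ) * τ * lapSymbol n l) * resolventSymbol n θ τ l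

lemma resolventSymbol_even (θ τ : ℝ) : Function.Even (resolventSymbol n θ τ) := fun l => by
  simp [resolventSymbol, lapSymbol_even l]

lemma stepSymbol_even (θ τ : ℝ) : Function.Even (stepSymbol n θ τ) := fun l => by
  simp [stepSymbol, lapSymbol_even l, resolventSymbol_even θ τ l]

lemma stepSymbol_pow_mul_even (θ τ : ℝ) {g : ZMod n → ℝ} (hg : Function.Even g) (i : ℕ) :
    Function.Even (stepSymbol n θ τ ^ i * g) := fun l => by
  simp [stepSymbol_even θ τ l, hg l]

lemma lapSymbol_zero : lapSymbol n 0 = 0 := by simp [lapSymbol, cosChar_zero]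

lemma resolventSymbol_zero (θ τ : ℝ) : resolventSymbol n θ τ 0 = 1 := by
  simp [resolventSymbol, lapSymbol_zero]

lemma stepSymbol_zero (θ τ : ℝ) : stepSymbol n θ τ 0 = 1 := by
  simp [stepSymbol, lapSymbol_zero, resolventSymbol_zero]

lemma lapSymbol_nonpos (l : ZMod n) : lapSymbol n l ≤ 0 :=
  mul_nonpos_of_nonneg_of_nonpos (by positivity) (by linarith [(abs_le.1 (abs_cosChar_le_one l)).2])

variable {θ τ : ℝ}

lemma one_le_one_sub_mul_lapSymbol (hθ : 0 ≤ θ) (hτ : 0 < τ) (l : ZMod n) :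
    1 ≤ 1 - θ * τ * lapSymbol n l := by
  have := mul_nonpos_of_nonneg_of_nonpos (mul_nonneg hθ hτ.le) (lapSymbol_nonpos l)
  linarith

lemma resolventSymbol_pos (hθ : 0 ≤ θ) (hτ : 0 < τ) (l : ZMod n) :
    0 < resolventSymbol n θ τ l :=
  inv_pos.2 (by linarith [one_le_one_sub_mul_lapSymbol hθ hτ l])

lemma resolventSymbol_le_one (hθ : 0 ≤ θ) (hτ : 0 < τ) (l : ZMod n) :
    resolventSymbol n θ τ l ≤ 1 :=
  inv_le_one_of_one_le₀ (one_le_one_sub_mul_lapSymbol hθ hτ l)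

lemma one_sub_stepSymbol_sq (hθ : 0 ≤ θ) (hτ : 0 < τ) (l : ZMod n) :
    1 - stepSymbol n θ τ l ^ 2 = (-(τ * lapSymbol n l)) * (2 - (2 * θ - 1) * (τ * lapSymbol n l))
      * resolventSymbol n θ τ l ^ 2 := by
  have h := (one_le_one_sub_mul_lapSymbol hθ hτ l)
  have h' : 1 - θ * τ * lapSymbol n l ≠ 0 := by linarith
  rw [stepSymbol, resolventSymbol]
  field_simp
  ring

/-- The step size condition bounds the damping of each Fourier mode from below, uniformly up to
the boundary of the stability region. -/
lemma one_add_cosChar_le (hτ : 0 < τ) (h : StepSizeCondition θ n τ) (l : ZMod n) :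
    1 + cosChar l ≤ 2 - (2 * θ - 1) * (τ * lapSymbol n l) := by
  obtain ⟨hc1, hc2⟩ := abs_le.1 (abs_cosChar_le_one l)
  have hnt : 0 < (n : ℝ) ^ 2 * τ := by
    have : (0 : ℝ) < n := Nat.cast_pos.2 (NeZero.pos n)
    positivity
  have e : τ * lapSymbol n l = -(2 * ((n : ℝ) ^ 2 * τ) * (1 - cosChar l)) := by
    rw [lapSymbol]; ring
  rw [e]
  rcases lt_or_ge θ (1 / 2) with hθ | hθ
  · obtain ⟨r, -, hr, hr2⟩ := h.1 hθ
    have h1 : (n : ℝ) ^ 2 * τ * (2 - 4 * θ) ≤ 1 := by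
      rw [lt_div_iff₀ (by linarith)] at hr2
      nlinarith
    nlinarith [mul_le_mul_of_nonneg_right h1 (sub_nonneg.2 hc2)]
  · have := mul_nonneg (mul_nonneg (by linarith : (0:ℝ) ≤ 2 * θ - 1) hnt.le) (sub_nonneg.2 hc2)
    nlinarith

lemma mul_resolventSymbol_sq_le_one_sub_stepSymbol_sq (hθ : 0 ≤ θ) (hτ : 0 < τ)
    (h : StepSizeCondition θ n τ) (l : ZMod n) :
    τ * (2 * (n : ℝ) ^ 2 * (1 - cosChar l ^ 2)) * resolventSymbol n θ τ l ^ 2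
      ≤ 1 - stepSymbol n θ τ l ^ 2 := by
  rw [one_sub_stepSymbol_sq hθ hτ]
  refine mul_le_mul_of_nonneg_right ?_ (sq_nonneg _)
  have h0 : 0 ≤ -(τ * lapSymbol n l) := by
    have := mul_nonpos_of_nonneg_of_nonpos hτ.le (lapSymbol_nonpos l); linarith
  have h1 := mul_le_mul_of_nonneg_left (one_add_cosChar_le hτ h l) h0
  refine le_trans (le_of_eq ?_) h1
  rw [lapSymbol]; ring

lemma one_sub_cosChar_sq_nonneg (l : ZMod n) : 0 ≤ 1 - cosChar l ^ 2 := by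
  have := sq_le_one_iff_abs_le_one (cosChar l) |>.2 (abs_cosChar_le_one l)
  linarith

lemma stepSymbol_sq_le_one (hθ : 0 ≤ θ) (hτ : 0 < τ) (h : StepSizeCondition θ n τ)
    (l : ZMod n) : stepSymbol n θ τ l ^ 2 ≤ 1 := by
  have h1 := mul_resolventSymbol_sq_le_one_sub_stepSymbol_sq hθ hτ h l
  have h2 : 0 ≤ τ * (2 * (n : ℝ) ^ 2 * (1 - cosChar l ^ 2)) * resolventSymbol n θ τ l ^ 2 := by
    have := one_sub_cosChar_sq_nonneg l
    positivity
  linarith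

lemma abs_stepSymbol_lt_one (hθ : 0 ≤ θ) (hτ : 0 < τ) (h : StepSizeCondition θ n τ)
    {l : ZMod n} (hl : l ≠ 0) : |stepSymbol n θ τ l| < 1 := by
  obtain ⟨hc1, hc2⟩ := abs_le.1 (abs_cosChar_le_one l)
  have hc : cosChar l < 1 := lt_of_le_of_ne hc2 fun h => hl (cosChar_eq_one_iff.1 h)
  have hnt : 0 < (n : ℝ) ^ 2 * τ := by
    have : (0 : ℝ) < n := Nat.cast_pos.2 (NeZero.pos n)
    positivity
  rw [← sq_lt_one_iff_abs_lt_one, ← sub_pos, one_sub_stepSymbol_sq hθ hτ]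
  have hR := resolventSymbol_pos hθ hτ l
  have e : τ * lapSymbol n l = -(2 * ((n : ℝ) ^ 2 * τ) * (1 - cosChar l)) := by
    rw [lapSymbol]; ring
  have h1 : 0 < -(τ * lapSymbol n l) := by
    rw [e, neg_neg]; exact mul_pos (by linarith) (by linarith)
  have h2 : 0 < 2 - (2 * θ - 1) * (τ * lapSymbol n l) := by
    rcases lt_or_ge θ (1 / 2) with hθ | hθ
    · obtain ⟨r, -, hr, hr2⟩ := h.1 hθ
      have h1 : (n : ℝ) ^ 2 * τ * (2 - 4 * θ) < 1 := by
        rw [lt_div_iff₀ (by linarith)] at hr2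
        nlinarith
      rw [e]
      nlinarith [mul_lt_mul_of_pos_right h1 (sub_pos.2 hc)]
    · nlinarith [mul_nonneg (by linarith : (0:ℝ) ≤ 2 * θ - 1) h1.le]
  positivity

/-- Discounted sum over time of one squared Fourier mode of the discrete heat kernel. -/
lemma tau_mul_sum_mode_le (hθ : 0 ≤ θ) (hτ : 0 < τ) (h : StepSizeCondition θ n τ)
    {β : ℝ} (hβ : 0 < β) (l : ZMod n) (m : ℕ) :
    τ * ∑ i ∈ Finset.range m, (stepSymbol n θ τ ^ i * resolventSymbol n θ τ) l ^ 2
        * Real.exp (-(β * τ * (i + 1)))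
      ≤ (β + 2 * (n : ℝ) ^ 2 * (1 - cosChar l ^ 2))⁻¹ := by
  set q := Real.exp (-(β * τ)) with hq
  set A := stepSymbol n θ τ l ^ 2 with hA
  set R := resolventSymbol n θ τ l ^ 2 with hR
  set D := 2 * (n : ℝ) ^ 2 * (1 - cosChar l ^ 2) with hD
  have hq0 : 0 < q := Real.exp_pos _
  have hq1 : q < 1 := by
    rw [← Real.exp_zero]; exact Real.exp_lt_exp.2 (by linarith [mul_pos hβ hτ])
  have hA0 : 0 ≤ A := sq_nonneg _
  have hA1 : A ≤ 1 := stepSymbol_sq_le_one hθ hτ h l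
  have hD0 : 0 ≤ D := by have := one_sub_cosChar_sq_nonneg l; positivity
  have hR0 : 0 < R := pow_pos (resolventSymbol_pos hθ hτ l) 2
  have hR1 : R ≤ 1 := pow_le_one₀ (resolventSymbol_pos hθ hτ l).le (resolventSymbol_le_one hθ hτ l)
  have hAq : A * q < 1 := by nlinarith
  have hsum : ∑ i ∈ Finset.range m, (stepSymbol n θ τ ^ i * resolventSymbol n θ τ) l ^ 2
        * Real.exp (-(β * τ * (i + 1))) = R * q * ∑ i ∈ Finset.range m, (A * q) ^ i := by
    rw [Finset.mul_sum]
    refine Finset.sum_congr rfl fun i _ => ?_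
    have : Real.exp (-(β * τ * (i + 1))) = q ^ i * q := by
      rw [hq, ← pow_succ, ← Real.exp_nat_mul]; congr 1; push_cast; ring
    rw [this, Pi.mul_apply, Pi.pow_apply, hA, hR]; ring
  have hgeom : ∑ i ∈ Finset.range m, (A * q) ^ i ≤ (1 - A * q)⁻¹ := by
    rw [← tsum_geometric_of_lt_one (by positivity) hAq]
    exact (summable_geometric_of_lt_one (by positivity) hAq).sum_le_tsum _
      fun i _ => by positivity
  have hqinv : (1 + β * τ) * q ≤ 1 := by
    have h1 : 1 + β * τ ≤ Real.exp (β * τ) := by linarith [Real.add_one_le_exp (β * τ)]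
    calc (1 + β * τ) * q ≤ Real.exp (β * τ) * q := mul_le_mul_of_nonneg_right h1 hq0.le
      _ = 1 := by rw [hq, ← Real.exp_add]; simp
  have hdamp : τ * D * R ≤ 1 - A :=
    mul_resolventSymbol_sq_le_one_sub_stepSymbol_sq hθ hτ h l
  rw [hsum]
  calc τ * (R * q * ∑ i ∈ Finset.range m, (A * q) ^ i)
      ≤ τ * (R * q * (1 - A * q)⁻¹) := by gcongr
    _ ≤ (β + D)⁻¹ := by
      rw [← mul_assoc, ← div_eq_mul_inv, div_le_iff₀ (by linarith), ← div_eq_inv_mul,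
        le_div_iff₀ (by positivity)]
      have h1 : τ * R * (β + D) ≤ β * τ + (1 - A) := by
        nlinarith [mul_le_mul_of_nonneg_left hR1 (mul_pos hβ hτ).le]
      have h2 := mul_le_mul_of_nonneg_right h1 hq0.le
      nlinarith

lemma inv_add_sq_le_telescope {β : ℝ} (hβ : 0 < β) (N : ℕ) :
    (β + 8 * ((N : ℝ) + 1) ^ 2)⁻¹ ≤ 2 * ((√β + N)⁻¹ - (√β + N + 1)⁻¹) := by
  have hb : 0 < √β := Real.sqrt_pos.2 hβ
  have hb2 : √β ^ 2 = β := Real.sq_sqrt hβ.le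
  have hN : (0 : ℝ) ≤ N := Nat.cast_nonneg N
  rw [inv_sub_inv (by positivity) (by positivity), ← mul_div_assoc, inv_eq_one_div,
    div_le_div_iff₀ (by positivity) (by positivity)]
  nlinarith [sq_nonneg (√β - N), mul_nonneg hb.le hN]

lemma sum_Icc_inv_add_sq_le {β : ℝ} (hβ : 0 < β) (N : ℕ) :
    ∑ w ∈ Finset.Icc (-(N : ℤ)) N, (β + 8 * (w : ℝ) ^ 2)⁻¹
      ≤ β⁻¹ + 4 * ((√β)⁻¹ - (√β + N)⁻¹) := by
  induction N with
  | zero => simp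
  | succ N ih =>
    have e : Finset.Icc (-((N + 1 : ℕ) : ℤ)) ((N + 1 : ℕ) : ℤ)
        = insert (-((N : ℤ) + 1)) (insert ((N : ℤ) + 1) (Finset.Icc (-(N : ℤ)) N)) := by
      ext w; simp only [Finset.mem_Icc, Finset.mem_insert]; omega
    rw [e, Finset.sum_insert (by simp only [Finset.mem_Icc, Finset.mem_insert]; omega),
      Finset.sum_insert (by simp only [Finset.mem_Icc]; omega)]
    have h := inv_add_sq_le_telescope hβ N
    push_cast
    rw [neg_sq, ← add_assoc (√β)]
    linarith

/-- Jordan's inequality for `sin (π z)` at `z = 2 v / n`, relative to the integer nearest to `z`. -/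
lemma exists_eight_mul_sq_le (v : ℕ) (hv : v < n) :
    ∃ k ∈ Finset.range 3, 8 * (((2 * v - k * n : ℤ)) : ℝ) ^ 2
      ≤ 2 * (n : ℝ) ^ 2 * Real.sin (2 * Real.pi * v / n) ^ 2 := by
  have hn : (0 : ℝ) < n := Nat.cast_pos.2 (NeZero.pos n)
  set z : ℝ := 2 * v / n with hz
  have hz0 : 0 ≤ z := by positivity
  have hz2 : z < 2 := by
    rw [hz, div_lt_iff₀ hn]
    have : (v : ℝ) < n := by exact_mod_cast hv
    linarith
  have hr := abs_sub_round z
  have hr' := abs_le.1 hr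
  have hk0 : 0 ≤ round z := by
    have : (-1 : ℝ) < round z := by linarith
    have : (-1 : ℤ) < round z := by exact_mod_cast this
    omega
  have hk2 : round z < 3 := by
    have : (round z : ℝ) < 3 := by linarith
    exact_mod_cast this
  refine ⟨(round z).toNat, by simp; omega, ?_⟩
  rw [Int.toNat_of_nonneg hk0]
  have hsin : Real.sin (2 * Real.pi * v / n) ^ 2 = Real.sin ((z - round z) * Real.pi) ^ 2 := by
    have h1 : ((-1 : ℝ) ^ round z) ^ 2 = 1 := by rw [← sq_abs, abs_zpow]; simp
    rw [sub_mul, Real.sin_sub_int_mul_pi, mul_pow, h1, one_mul, hz]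
    congr 2; ring
  have hj : 2 * |z - round z| ≤ |Real.sin ((z - round z) * Real.pi)| := by
    have h := Real.mul_abs_le_abs_sin (x := (z - round z) * Real.pi) (by
      rw [abs_mul, abs_of_pos Real.pi_pos]; nlinarith [Real.pi_pos])
    rw [abs_mul, abs_of_pos Real.pi_pos] at h
    refine le_trans (le_of_eq ?_) h
    field_simp
  rw [hsin]
  have hsq : (2 * |z - round z|) ^ 2 ≤ Real.sin ((z - round z) * Real.pi) ^ 2 := by
    rw [← sq_abs (Real.sin _)]
    exact pow_le_pow_left₀ (by positivity) hj 2
  rw [mul_pow, sq_abs] at hsq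
  have e : ((2 * v - round z * n : ℤ) : ℝ) = n * (z - round z) := by
    push_cast; rw [hz]; field_simp
  rw [e, mul_pow]
  nlinarith [mul_le_mul_of_nonneg_left hsq (sq_nonneg (n : ℝ))]

/-- Bound for the discounted heat kernel on the diagonal, in terms of the discount rate `β` only:
`sin² (2 π l / n)` vanishes to second order at `l = 0`, `n / 2`, `n`, whence three lattice sums. -/
lemma sum_inv_add_cosChar_le {β : ℝ} (hβ : 0 < β) :
    ∑ l : ZMod n, (β + 2 * (n : ℝ) ^ 2 * (1 - cosChar l ^ 2))⁻¹ ≤ 3 / β + 12 / √β := by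
  have hb : 0 < √β := Real.sqrt_pos.2 hβ
  have h1 : ∀ l : ZMod n, (β + 2 * (n : ℝ) ^ 2 * (1 - cosChar l ^ 2))⁻¹
      ≤ ∑ k ∈ Finset.range 3, (β + 8 * ((2 * l.val - k * n : ℤ) : ℝ) ^ 2)⁻¹ := fun l => by
    obtain ⟨k, hk, h⟩ := exists_eight_mul_sq_le (n := n) l.val (ZMod.val_lt l)
    rw [cosChar_eq_cos, ← Real.sin_sq]
    refine le_trans ?_ (Finset.single_le_sum (f := fun k : ℕ =>
      (β + 8 * ((2 * l.val - k * n : ℤ) : ℝ) ^ 2)⁻¹) (fun i _ => by positivity) hk)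
    exact inv_anti₀ (by positivity) (by linarith)
  have h2 : ∀ k ∈ Finset.range 3, ∑ l : ZMod n, (β + 8 * ((2 * l.val - k * n : ℤ) : ℝ) ^ 2)⁻¹
      ≤ β⁻¹ + 4 * (√β)⁻¹ := fun k hk => by
    have hk3 : k < 3 := Finset.mem_range.1 hk
    have hinj : Function.Injective fun l : ZMod n => (2 * l.val - k * n : ℤ) := fun a b hab => by
      apply ZMod.val_injective n
      simp only at hab
      omega
    have h3 : ∑ l : ZMod n, (β + 8 * ((2 * l.val - k * n : ℤ) : ℝ) ^ 2)⁻¹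
        = ∑ w ∈ Finset.univ.image (fun l : ZMod n => (2 * l.val - k * n : ℤ)),
          (β + 8 * (w : ℝ) ^ 2)⁻¹ := by
      rw [Finset.sum_image fun a _ b _ hab => hinj hab]
    rw [h3]
    have hsub : Finset.univ.image (fun l : ZMod n => (2 * l.val - k * n : ℤ))
        ⊆ Finset.Icc (-((2 * n : ℕ) : ℤ)) ((2 * n : ℕ) : ℤ) := fun w hw => by
      obtain ⟨l, -, rfl⟩ := Finset.mem_image.1 hw
      have := ZMod.val_lt l
      rw [Finset.mem_Icc]
      interval_cases k <;> push_cast <;> omega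
    refine (Finset.sum_le_sum_of_subset_of_nonneg hsub fun _ _ _ => by positivity).trans
      ((sum_Icc_inv_add_sq_le hβ (2 * n)).trans ?_)
    have : 0 ≤ (√β + (2 * n : ℕ))⁻¹ := by positivity
    linarith
  calc _ ≤ ∑ l : ZMod n, ∑ k ∈ Finset.range 3, (β + 8 * ((2 * l.val - k * n : ℤ) : ℝ) ^ 2)⁻¹ :=
        Finset.sum_le_sum fun l _ => h1 l
    _ ≤ ∑ k ∈ Finset.range 3, (β⁻¹ + 4 * (√β)⁻¹) := by
        rw [Finset.sum_comm]; exact Finset.sum_le_sum h2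
    _ = _ := by rw [Finset.sum_const]; simp; ring

/-- The squared `ℓ²` norm of the discrete heat kernel, weighted as a space-time density and
discounted at rate `β`, is bounded uniformly in the step sizes. -/
lemma tau_mul_sum_kernel_sq_le (hθ : 0 ≤ θ) (hτ : 0 < τ) (h : StepSizeCondition θ n τ)
    {β : ℝ} (hβ : 0 < β) (j : ZMod n) (m : ℕ) :
    τ * ∑ i ∈ Finset.range m, (n * ∑ k,
        kernel (stepSymbol n θ τ ^ i * resolventSymbol n θ τ) (k - j) ^ 2)
          * Real.exp (-(β * τ * (i + 1)))
      ≤ 3 / β + 12 / √β := by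
  have hn : (n : ℝ) ≠ 0 := Nat.cast_ne_zero.2 (NeZero.ne n)
  refine le_trans (le_of_eq ?_) ((Finset.sum_le_sum fun l _ =>
    tau_mul_sum_mode_le hθ hτ h hβ l m).trans (sum_inv_add_cosChar_le hβ))
  simp_rw [sum_kernel_sq (stepSymbol_pow_mul_even θ τ (resolventSymbol_even θ τ) _)]
  rw [← Finset.mul_sum, Finset.sum_comm]
  congr 1
  refine Finset.sum_congr rfl fun i _ => ?_
  rw [mul_inv_cancel_left₀ hn, Finset.sum_mul]

/-- Over many steps the discrete heat flow converges to the mean. -/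
lemma tendsto_mult_stepSymbol_pow (hθ : 0 ≤ θ) (hτ : 0 < τ) (h : StepSizeCondition θ n τ)
    (c : ZMod n → ℝ) (j : ZMod n) :
    Tendsto (fun i : ℕ => mult (stepSymbol n θ τ ^ i * resolventSymbol n θ τ) c j) atTop
      (𝓝 ((n : ℝ)⁻¹ * ∑ k, c k)) := by
  rw [Finset.mul_sum]
  refine tendsto_finsetSum _ fun k _ => Tendsto.mul_const _ ?_
  have e : (n : ℝ)⁻¹ = (n : ℝ)⁻¹ * ∑ l : ZMod n, if l = 0 then (1 : ℝ) else 0 := by simp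
  rw [e]
  refine Tendsto.const_mul _ (tendsto_finsetSum _ fun l _ => ?_)
  by_cases hl : l = 0
  · subst hl
    simp [stepSymbol_zero, resolventSymbol_zero, cosChar_zero]
  · have h1 := tendsto_pow_atTop_nhds_zero_of_abs_lt_one (abs_stepSymbol_lt_one hθ hτ h hl)
    have h2 := (h1.mul_const (resolventSymbol n θ τ l)).mul_const (cosChar (l * (j - k)))
    simpa [hl] using h2

/-- The implicit scheme, solved for the new time level. -/
lemma scheme_iff (hθ : 0 ≤ θ) (hτ : 0 < τ) (u u' ζ : ZMod n → ℝ) :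
    (∀ j, u' j = u j + (1 - θ) * τ * discreteLaplacian n u j
        + θ * τ * discreteLaplacian n u' j + ζ j) ↔
      u' = mult (stepSymbol n θ τ) u + mult (resolventSymbol n θ τ) ζ := by
  set R := resolventSymbol n θ τ
  set D : ZMod n → ℝ := 1 + (-(θ * τ)) • lapSymbol n with hD
  set N : ZMod n → ℝ := 1 + ((1 - θ) * τ) • lapSymbol n with hN
  have hDe : Function.Even D := fun l => by simp [hD, lapSymbol_even l]
  have hNe : Function.Even N := fun l => by simp [hN, lapSymbol_even l]
  have hRe : Function.Even R := resolventSymbol_even θ τ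
  have hDR : D * R = 1 := by
    ext l
    have := one_le_one_sub_mul_lapSymbol hθ hτ l
    have h' : 1 - θ * τ * lapSymbol n l ≠ 0 := by linarith
    simp only [Pi.mul_apply, hD, R, resolventSymbol, Pi.add_apply, Pi.one_apply, Pi.smul_apply,
      smul_eq_mul]
    rw [neg_mul, ← sub_eq_add_neg, mul_inv_cancel₀ h']
  have hS : stepSymbol n θ τ = R * N := by
    ext l
    simp only [stepSymbol, Pi.mul_apply, hN, R, Pi.add_apply, Pi.one_apply, Pi.smul_apply,
      smul_eq_mul]
    ring
  have hDu : ∀ v : ZMod n → ℝ, ∀ j, mult D v j = v j - θ * τ * discreteLaplacian n v j :=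
    fun v j => by
      rw [hD, mult_add_left, mult_smul_left, mult_one, ← discreteLaplacian_eq_mult]
      simp [sub_eq_add_neg]
  have hNu : ∀ v : ZMod n → ℝ, ∀ j, mult N v j = v j + (1 - θ) * τ * discreteLaplacian n v j :=
    fun v j => by
      rw [hN, mult_add_left, mult_smul_left, mult_one, ← discreteLaplacian_eq_mult]
      simp
  have h1 : (∀ j, u' j = u j + (1 - θ) * τ * discreteLaplacian n u j
        + θ * τ * discreteLaplacian n u' j + ζ j) ↔ mult D u' = mult N u + ζ := by
    rw [funext_iff]
    refine forall_congr' fun j => ?_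
    rw [hDu, Pi.add_apply, hNu]
    constructor <;> intro h <;> linarith
  rw [h1, hS, ← mult_mult hRe hNe, ← mult_add_right]
  constructor
  · intro h
    rw [← h, mult_mult hRe hDe, mul_comm R D, hDR, mult_one]
  · intro h
    rw [h, mult_mult hDe hRe, hDR, mult_one]

end Symbols

/-! ### Normalised increments of the Brownian sheet -/

section Noise

variable {Ω : Type*} [MeasurableSpace Ω] {P : Measure Ω} {n : ℕ} [NeZero n]

/-- An array of independent standard normal random variables, in the form in which it is used:
the time slices are independent, and linear combinations within a slice are normal. -/
structure IsStandardNoise (P : Measure Ω) (η : ℕ → ZMod n → Ω → ℝ) : Prop where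
  aemeasurable : ∀ i k, AEMeasurable (η i k) P
  indep : iIndepFun (fun i ω k => η i k ω) P
  map_sum : ∀ (i : ℕ) (a : ZMod n → ℝ),
    P.map (fun ω => ∑ k, a k * η i k ω) = gaussianReal 0 (∑ k, a k ^ 2).toNNReal

/-- The increment of `W` over the rectangle `[i τ, (i + 1) τ] × [x_k, x_{k+1}]`, normalised to unit
variance. -/
noncomputable def stdNoise (n : ℕ) (τ : ℝ) (W : ℝ → ℝ → Ω → ℝ) (i : ℕ) (k : ZMod n) (ω : Ω) : ℝ :=
  √(τ / n) * noiseIncrement n τ W i k ω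

lemma cell_mem (k : ZMod n) : (k.val : ℝ) / n ∈ Set.Icc (0 : ℝ) 1 ∧
    ((k.val : ℝ) + 1) / n ∈ Set.Icc (0 : ℝ) 1 := by
  have hn : (0 : ℝ) < n := Nat.cast_pos.2 (NeZero.pos n)
  have hk : (k.val : ℝ) + 1 ≤ n := by exact_mod_cast ZMod.val_lt k
  refine ⟨⟨by positivity, ?_⟩, ⟨by positivity, ?_⟩⟩ <;> rw [div_le_one hn] <;> linarith

variable {W : ℝ → ℝ → Ω → ℝ} {τ : ℝ}

lemma IsBrownianSheet.hasGaussianLaw (hW : IsBrownianSheet P W) {t x : ℝ} (ht : 0 ≤ t)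
    (hx : x ∈ Set.Icc (0 : ℝ) 1) : HasGaussianLaw (W t x) P :=
  hW.gaussian.hasGaussianLaw_eval ⟨(t, x), ht, hx⟩

lemma IsBrownianSheet.isGaussianProcess_stdNoise (hW : IsBrownianSheet P W) (hτ : 0 < τ) :
    IsGaussianProcess (fun q : (_ : ℕ) × ZMod n => stdNoise n τ W q.1 q.2) P := by
  classical
  refine hW.gaussian.of_isGaussianProcess fun s => ?_
  obtain ⟨i, k⟩ := s
  obtain ⟨hx, hx'⟩ := cell_mem k
  have ht : (0 : ℝ) ≤ i * τ := by positivity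
  have ht' : (0 : ℝ) ≤ (i + 1) * τ := by positivity
  let q₁ : (Set.Ici (0 : ℝ) ×ˢ Set.Icc (0 : ℝ) 1 : Set (ℝ × ℝ)) :=
    ⟨((i + 1) * τ, ((k.val : ℝ) + 1) / n), ht', hx'⟩
  let q₂ : (Set.Ici (0 : ℝ) ×ˢ Set.Icc (0 : ℝ) 1 : Set (ℝ × ℝ)) :=
    ⟨(i * τ, ((k.val : ℝ) + 1) / n), ht, hx'⟩
  let q₃ : (Set.Ici (0 : ℝ) ×ˢ Set.Icc (0 : ℝ) 1 : Set (ℝ × ℝ)) :=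
    ⟨((i + 1) * τ, (k.val : ℝ) / n), ht', hx⟩
  let q₄ : (Set.Ici (0 : ℝ) ×ˢ Set.Icc (0 : ℝ) 1 : Set (ℝ × ℝ)) :=
    ⟨(i * τ, (k.val : ℝ) / n), ht, hx⟩
  let I : Finset (Set.Ici (0 : ℝ) ×ˢ Set.Icc (0 : ℝ) 1 : Set (ℝ × ℝ)) := {q₁, q₂, q₃, q₄}
  refine ⟨I, (√(τ / n) * (n * τ⁻¹)) • (
    (ContinuousLinearMap.proj (R := ℝ) (φ := fun _ : I => ℝ) ⟨q₁, by simp [I]⟩)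
    - (ContinuousLinearMap.proj (R := ℝ) (φ := fun _ : I => ℝ) ⟨q₂, by simp [I]⟩)
    - (ContinuousLinearMap.proj (R := ℝ) (φ := fun _ : I => ℝ) ⟨q₃, by simp [I]⟩)
    + (ContinuousLinearMap.proj (R := ℝ) (φ := fun _ : I => ℝ) ⟨q₄, by simp [I]⟩)), fun ω => ?_⟩
  simp [stdNoise, noiseIncrement, q₁, q₂, q₃, q₄, mul_assoc]
  ring

lemma min_increment (i j : ℕ) {h : ℝ} (hh : 0 ≤ h) :
    min (((i : ℝ) + 1) * h) ((j + 1) * h) - min ((i + 1) * h) (j * h)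
      - (min (i * h) ((j + 1) * h) - min (i * h) (j * h)) = if i = j then h else 0 := by
  rcases lt_trichotomy i j with hij | rfl | hij
  · have : (i : ℝ) + 1 ≤ j := by exact_mod_cast hij
    rw [if_neg hij.ne, min_eq_left (by nlinarith), min_eq_left (by nlinarith),
      min_eq_left (by nlinarith), min_eq_left (by nlinarith)]
    ring
  · rw [if_pos rfl, min_self, min_self, min_eq_right (by nlinarith), min_eq_left (by nlinarith)]
    ring
  · have : (j : ℝ) + 1 ≤ i := by exact_mod_cast hij
    rw [if_neg hij.ne', min_eq_right (by nlinarith), min_eq_right (by nlinarith),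
      min_eq_right (by nlinarith), min_eq_right (by nlinarith)]
    ring

lemma IsBrownianSheet.covariance_stdNoise [IsProbabilityMeasure P] (hW : IsBrownianSheet P W)
    (hτ : 0 < τ) (i j : ℕ) (k l : ZMod n) :
    covariance (stdNoise n τ W i k) (stdNoise n τ W j l) P = if i = j ∧ k = l then 1 else 0 := by
  have hn : (0 : ℝ) < n := Nat.cast_pos.2 (NeZero.pos n)
  have hT : ∀ i : ℕ, (0 : ℝ) ≤ i * τ := fun i => by positivity
  have hT' : ∀ i : ℕ, (0 : ℝ) ≤ (i + 1) * τ := fun i => by positivity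
  have hL : ∀ {t x : ℝ}, 0 ≤ t → x ∈ Set.Icc (0 : ℝ) 1 → MemLp (W t x) 2 P :=
    fun ht hx => (hW.hasGaussianLaw ht hx).memLp_two
  have hLd : ∀ {t t' x : ℝ}, 0 ≤ t → 0 ≤ t' → x ∈ Set.Icc (0 : ℝ) 1 →
      MemLp (fun ω => W t' x ω - W t x ω) 2 P :=
    fun ht ht' hx => (hL ht' hx).sub (hL ht hx)
  have hd : ∀ {x y : ℝ}, x ∈ Set.Icc (0 : ℝ) 1 → y ∈ Set.Icc (0 : ℝ) 1 →
      covariance (fun ω => W ((i + 1) * τ) x ω - W (i * τ) x ω)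
        (fun ω => W ((j + 1) * τ) y ω - W (j * τ) y ω) P
      = (if i = j then τ else 0) * min x y := fun {x y} hx hy => by
    rw [covariance_fun_sub_fun_sub (hL (hT' i) hx) (hL (hT i) hx) (hL (hT' j) hy) (hL (hT j) hy),
      hW.cov _ _ _ _ (hT' i) (hT' j) hx hy, hW.cov _ _ _ _ (hT' i) (hT j) hx hy,
      hW.cov _ _ _ _ (hT i) (hT' j) hx hy, hW.cov _ _ _ _ (hT i) (hT j) hx hy,
      ← min_increment i j hτ.le]
    ring
  have hform : ∀ (i : ℕ) (k : ZMod n), stdNoise n τ W i k = fun ω => (√(τ / n) * (n * τ⁻¹)) *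
      ((W ((i + 1) * τ) ((k.val + 1) / n) ω - W (i * τ) ((k.val + 1) / n) ω)
        - (W ((i + 1) * τ) (k.val / n) ω - W (i * τ) (k.val / n) ω)) := fun i k => by
    ext ω; simp only [stdNoise, noiseIncrement]; ring
  obtain ⟨hx, hx'⟩ := cell_mem k
  obtain ⟨hy, hy'⟩ := cell_mem l
  rw [hform, hform, covariance_const_mul_left, covariance_const_mul_right,
    covariance_fun_sub_fun_sub (hLd (hT i) (hT' i) hx') (hLd (hT i) (hT' i) hx)
      (hLd (hT j) (hT' j) hy') (hLd (hT j) (hT' j) hy),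
    hd hx' hy', hd hx' hy, hd hx hy', hd hx hy]
  have hsp := min_increment k.val l.val (h := (n : ℝ)⁻¹) (by positivity)
  simp only [← div_eq_mul_inv] at hsp
  have hval : k.val = l.val ↔ k = l := (ZMod.val_injective n).eq_iff
  have e : ∀ (s a b c d : ℝ), s * a - s * b - s * c + s * d = s * (a - b - (c - d)) := by
    intros; ring
  rw [e, hsp]
  simp only [hval]
  have hs : √(τ / n) * √(τ / n) = τ / n := Real.mul_self_sqrt (by positivity)
  by_cases h1 : i = j
  · by_cases h2 : k = l
    · rw [if_pos h1, if_pos h2, if_pos ⟨h1, h2⟩]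
      calc √(τ / n) * (n * τ⁻¹) * (√(τ / n) * (n * τ⁻¹) * (τ * (n : ℝ)⁻¹))
          = (√(τ / n) * √(τ / n)) * ((n * τ⁻¹) * (n * τ⁻¹) * (τ * (n : ℝ)⁻¹)) := by ring
        _ = 1 := by rw [hs]; field_simp
    · simp [h2]
  · simp [h1]

lemma IsBrownianSheet.integral_stdNoise [IsProbabilityMeasure P] (hW : IsBrownianSheet P W)
    (hτ : 0 < τ) (i : ℕ) (k : ZMod n) : ∫ ω, stdNoise n τ W i k ω ∂P = 0 := by
  obtain ⟨hx, hx'⟩ := cell_mem k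
  have ht : (0 : ℝ) ≤ i * τ := by positivity
  have ht' : (0 : ℝ) ≤ (i + 1) * τ := by positivity
  have hI : ∀ {t x : ℝ}, 0 ≤ t → x ∈ Set.Icc (0 : ℝ) 1 → Integrable (W t x) P :=
    fun ht hx => (hW.hasGaussianLaw ht hx).integrable
  simp only [stdNoise, noiseIncrement]
  have h1 : Integrable (fun ω => W ((i + 1) * τ) ((k.val + 1) / n) ω
      - W (i * τ) ((k.val + 1) / n) ω) P := (hI ht' hx').sub (hI ht hx')
  have h2 : Integrable (fun ω => W ((i + 1) * τ) ((k.val + 1) / n) ω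
      - W (i * τ) ((k.val + 1) / n) ω - W ((i + 1) * τ) (k.val / n) ω) P := h1.sub (hI ht' hx)
  rw [integral_const_mul, integral_const_mul, integral_add h2 (hI ht hx),
    integral_sub h1 (hI ht' hx), integral_sub (hI ht' hx') (hI ht hx'), hW.mean _ _ ht' hx',
    hW.mean _ _ ht hx', hW.mean _ _ ht' hx, hW.mean _ _ ht hx]
  simp

lemma IsBrownianSheet.isStandardNoise [IsProbabilityMeasure P] (hW : IsBrownianSheet P W)
    (hτ : 0 < τ) : IsStandardNoise P (stdNoise n τ W) := by
  have hG := hW.isGaussianProcess_stdNoise (n := n) hτ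
  have hm : ∀ i k, AEMeasurable (stdNoise n τ W i k) P := fun i k => hG.aemeasurable ⟨i, k⟩
  have hL : ∀ i k, MemLp (stdNoise n τ W i k) 2 P := fun i k =>
    (hG.hasGaussianLaw_eval ⟨i, k⟩).memLp_two
  refine ⟨hm, ?_, fun i a => ?_⟩
  · refine IsGaussianProcess.iIndepFun_of_covariance_eq_zero (S := fun _ : ℕ => ZMod n) hG hm
      fun i j hij k l => ?_
    rw [hW.covariance_stdNoise hτ, if_neg fun h => hij h.1]
  · have hG' := (hG.comp_right (fun k : ZMod n => ⟨i, k⟩)).smul a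
    have hsum := hG'.hasGaussianLaw_fun_sum (I := Finset.univ)
    simp only [Function.comp_apply, smul_eq_mul] at hsum
    have hLa : ∀ k, MemLp (fun ω => a k * stdNoise n τ W i k ω) 2 P := fun k => (hL i k).const_mul _
    rw [hsum.map_eq_gaussianReal]
    congr 2
    · rw [integral_finsetSum _ fun k _ => (hLa k).integrable (by norm_num)]
      simp [integral_const_mul, hW.integral_stdNoise hτ]
    · rw [← covariance_self hsum.aemeasurable, covariance_fun_sum_fun_sum hLa hLa]
      refine Finset.sum_congr rfl fun k _ => ?_
      simp only [covariance_const_mul_left, covariance_const_mul_right, hW.covariance_stdNoise hτ]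
      simp [sq]

end Noise

/-! ### The scheme as a Markov chain driven by normal variables -/

section Chain

variable {Ω : Type*} [MeasurableSpace Ω] {P : Measure Ω} {n : ℕ} [NeZero n]

/-- One step of the scheme, solved for the new time level, with standard normal input `y`. -/
noncomputable def stepMap (θ τ lam : ℝ) (σ : ℝ → ℝ) (v y : ZMod n → ℝ) : ZMod n → ℝ :=
  mult (stepSymbol n θ τ) v
    + mult (resolventSymbol n θ τ) (fun k => lam * √(τ * n) * σ (v k) * y k)

/-- The solution of the scheme after `i` steps as a function of the initial value `v₀` and the
sequence `y` of standard normal inputs. -/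
noncomputable def path (θ τ lam : ℝ) (σ : ℝ → ℝ) (v₀ : ZMod n → ℝ) :
    ℕ → (ℕ → ZMod n → ℝ) → ZMod n → ℝ
  | 0, _ => v₀
  | i + 1, y => stepMap θ τ lam σ (path θ τ lam σ v₀ i y) (y i)

variable {θ τ lam : ℝ} {σ : ℝ → ℝ} {v₀ : ZMod n → ℝ}

lemma continuous_stepMap (hσ : Continuous σ) :
    Continuous fun q : (ZMod n → ℝ) × (ZMod n → ℝ) => stepMap θ τ lam σ q.1 q.2 := by
  unfold stepMap mult
  refine Continuous.add ?_ ?_ <;> fun_prop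

lemma continuous_path (hσ : Continuous σ) (i : ℕ) : Continuous (path θ τ lam σ v₀ i) := by
  induction i with
  | zero => exact continuous_const
  | succ i ih => exact (continuous_stepMap hσ).comp (ih.prodMk (continuous_apply i))

lemma path_congr {i : ℕ} {y y' : ℕ → ZMod n → ℝ} (h : ∀ q < i, y q = y' q) :
    path θ τ lam σ v₀ i y = path θ τ lam σ v₀ i y' := by
  induction i with
  | zero => rfl
  | succ i ih => rw [path, path, ih fun q hq => h q (by omega), h i (by omega)]

lemma dotProduct_stepMap (c v y : ZMod n → ℝ) :
    c ⬝ᵥ stepMap θ τ lam σ v y = mult (stepSymbol n θ τ) c ⬝ᵥ v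
      + ∑ k, (lam * √(τ * n) * mult (resolventSymbol n θ τ) c k * σ (v k)) * y k := by
  rw [stepMap, dotProduct_add, dotProduct_mult, dotProduct_mult]
  congr 1
  exact Finset.sum_congr rfl fun k _ => by ring

lemma sum_coeff_sq (hτ : 0 < τ) (c v : ZMod n → ℝ) :
    ∑ k, (lam * √(τ * n) * mult (resolventSymbol n θ τ) c k * σ (v k)) ^ 2
      = lam ^ 2 * τ * n * ∑ k, mult (resolventSymbol n θ τ) c k ^ 2 * σ (v k) ^ 2 := by
  rw [Finset.mul_sum]
  refine Finset.sum_congr rfl fun k _ => ?_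
  rw [mul_pow, mul_pow, mul_pow, Real.sq_sqrt (by positivity)]; ring

/-- The solution of the scheme driven by the noise `η`. -/
noncomputable def noisePath (θ τ lam : ℝ) (σ : ℝ → ℝ) (v₀ : ZMod n → ℝ) (η : ℕ → ZMod n → Ω → ℝ)
    (i : ℕ) (ω : Ω) : ZMod n → ℝ :=
  path θ τ lam σ v₀ i (fun q k => η q k ω)

variable {η : ℕ → ZMod n → Ω → ℝ}

lemma IsStandardNoise.aemeasurable_slice (hη : IsStandardNoise P η) (i : ℕ) :
    AEMeasurable (fun ω k => η i k ω) P :=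
  aemeasurable_pi_lambda _ fun k => hη.aemeasurable i k

lemma IsStandardNoise.aemeasurable_noisePath (hη : IsStandardNoise P η) (hσ : Continuous σ)
    (i : ℕ) : AEMeasurable (noisePath θ τ lam σ v₀ η i) P :=
  (continuous_path hσ i).measurable.comp_aemeasurable
    (aemeasurable_pi_lambda _ fun q => hη.aemeasurable_slice q)

/-- The solution up to time `i` is independent of the noise in the following time step. -/
lemma IsStandardNoise.indepFun_noisePath (hη : IsStandardNoise P η) (hσ : Continuous σ) (i : ℕ) :
    IndepFun (noisePath θ τ lam σ v₀ η i) (fun ω k => η i k ω) P := by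
  have h := hη.indep.indepFun_finset₀ (Finset.range i) {i} (by simp)
    (fun q => hη.aemeasurable_slice q)
  let F : (Finset.range i → ZMod n → ℝ) → ZMod n → ℝ := fun z =>
    path θ τ lam σ v₀ i (fun q => if hq : q ∈ Finset.range i then z ⟨q, hq⟩ else 0)
  have hF : Measurable F := by
    refine (continuous_path hσ i).measurable.comp (measurable_pi_lambda _ fun q => ?_)
    split_ifs with hq
    · exact measurable_pi_apply _
    · exact measurable_const
  have h' := h.comp hF (measurable_pi_apply (⟨i, by simp⟩ : ({i} : Finset ℕ)))
  have e : noisePath θ τ lam σ v₀ η i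
      = F ∘ fun ω (q : Finset.range i) k => η q k ω := by
    ext1 ω
    simp only [Function.comp_apply, F, noisePath]
    refine path_congr fun q hq => ?_
    simp [hq]
  rw [e]
  exact h'

lemma lintegral_indep_pair [IsProbabilityMeasure P] {E F : Type*} [MeasurableSpace E]
    [MeasurableSpace F] {X : Ω → E} {Y : Ω → F} (hX : AEMeasurable X P) (hY : AEMeasurable Y P)
    (h : IndepFun X Y P) {G : E × F → ℝ≥0∞} (hG : Measurable G) :
    ∫⁻ ω, G (X ω, Y ω) ∂P = ∫⁻ ω, ∫⁻ ω', G (X ω, Y ω') ∂P ∂P := by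
  rw [← lintegral_map' (f := G) (g := fun ω => (X ω, Y ω)) hG.aemeasurable (hX.prodMk hY),
    (indepFun_iff_map_prod_eq_prod_map_map hX hY).1 h]
  have : IsProbabilityMeasure (P.map Y) := Measure.isProbabilityMeasure_map hY
  have : IsProbabilityMeasure (P.map X) := Measure.isProbabilityMeasure_map hX
  rw [lintegral_prod _ hG.aemeasurable, lintegral_map' hG.lintegral_prod_right'.aemeasurable hX]
  refine lintegral_congr fun ω => ?_
  rw [lintegral_map' (by fun_prop) hY]

/-- Conditionally on the present, a linear functional of the solution at the next time level is
normal. -/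
lemma IsStandardNoise.lintegral_noisePath_succ [IsProbabilityMeasure P] (hη : IsStandardNoise P η)
    (hσ : Continuous σ) (hτ : 0 < τ) (c : ZMod n → ℝ) (i : ℕ) {f : ℝ → ℝ≥0∞} (hf : Measurable f) :
    ∫⁻ ω, f (c ⬝ᵥ noisePath θ τ lam σ v₀ η (i + 1) ω) ∂P
      = ∫⁻ ω, ∫⁻ z, f (mult (stepSymbol n θ τ) c ⬝ᵥ noisePath θ τ lam σ v₀ η i ω + z)
          ∂(gaussianReal 0 (lam ^ 2 * τ * n * ∑ k, mult (resolventSymbol n θ τ) c k ^ 2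
            * σ (noisePath θ τ lam σ v₀ η i ω k) ^ 2).toNNReal) ∂P := by
  have hdot : Continuous fun v : ZMod n → ℝ => c ⬝ᵥ v := by
    unfold dotProduct; fun_prop
  have h := lintegral_indep_pair (hη.aemeasurable_noisePath (θ := θ) (τ := τ) (lam := lam)
    (v₀ := v₀) hσ i) (hη.aemeasurable_slice i) (hη.indepFun_noisePath hσ i)
    (G := fun q => f (c ⬝ᵥ stepMap θ τ lam σ q.1 q.2))
    (hf.comp (hdot.comp (continuous_stepMap hσ)).measurable)
  refine Eq.trans h (lintegral_congr fun ω => ?_)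
  simp only [dotProduct_stepMap]
  rw [← sum_coeff_sq hτ, ← hη.map_sum i, lintegral_map' (by fun_prop)]
  exact Finset.aemeasurable_fun_sum _ fun k _ => (hη.aemeasurable i k).const_mul _

lemma IsStandardNoise.aemeasurable_dotProduct (hη : IsStandardNoise P η)
    (hσ : Continuous σ) (c : ZMod n → ℝ) (i : ℕ) :
    AEMeasurable (fun ω => c ⬝ᵥ noisePath θ τ lam σ v₀ η i ω) P := by
  have hdot : Continuous fun v : ZMod n → ℝ => c ⬝ᵥ v := by
    unfold dotProduct; fun_prop
  exact hdot.measurable.comp_aemeasurable (hη.aemeasurable_noisePath hσ i)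

end Chain

/-! ### Minkowski's inequality for nonnegative random variables -/

section Minkowski

variable {Ω : Type*} [MeasurableSpace Ω] {P : Measure Ω}

/-- The `L^r` norm of a nonnegative random variable. -/
noncomputable def lpNorm (P : Measure Ω) (r : ℝ) (f : Ω → ℝ≥0∞) : ℝ≥0∞ :=
  (∫⁻ ω, f ω ^ r ∂P) ^ (1 / r)

lemma lpNorm_add_le {r : ℝ} (hr : 1 ≤ r) {f g : Ω → ℝ≥0∞} (hf : AEMeasurable f P)
    (hg : AEMeasurable g P) :
    lpNorm P r (fun ω => f ω + g ω) ≤ lpNorm P r f + lpNorm P r g :=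
  ENNReal.lintegral_Lp_add_le hf hg hr

lemma lpNorm_sum_le {r : ℝ} (hr : 1 ≤ r) {ι : Type*} (s : Finset ι) {f : ι → Ω → ℝ≥0∞}
    (hf : ∀ k, AEMeasurable (f k) P) :
    lpNorm P r (fun ω => ∑ k ∈ s, f k ω) ≤ ∑ k ∈ s, lpNorm P r (f k) := by
  classical
  induction s using Finset.induction with
  | empty =>
    have hr0 : 0 < r := by linarith
    simp [lpNorm, hr0]
  | insert k s hk ih =>
    simp only [Finset.sum_insert hk]
    exact (lpNorm_add_le hr (hf k) (Finset.aemeasurable_fun_sum _ fun k _ => hf k)).trans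
      (add_le_add_right ih _)

lemma lpNorm_const_mul {r : ℝ} (hr : 1 ≤ r) {f : Ω → ℝ≥0∞} (hf : AEMeasurable f P) (a : ℝ≥0∞) :
    lpNorm P r (fun ω => a * f ω) = a * lpNorm P r f := by
  have hr0 : 0 < r := by linarith
  simp only [lpNorm, ENNReal.mul_rpow_of_nonneg _ _ hr0.le]
  rw [lintegral_const_mul'' _ (hf.pow_const r), ENNReal.mul_rpow_of_nonneg _ _ (by positivity),
    ← ENNReal.rpow_mul, mul_one_div_cancel hr0.ne', ENNReal.rpow_one]

lemma lpNorm_const [IsProbabilityMeasure P] {r : ℝ} (hr : 1 ≤ r) (a : ℝ≥0∞) :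
    lpNorm P r (fun _ => a) = a := by
  have hr0 : 0 < r := by linarith
  simp only [lpNorm, lintegral_const, measure_univ, mul_one]
  rw [← ENNReal.rpow_mul, mul_one_div_cancel hr0.ne', ENNReal.rpow_one]

end Minkowski

/-! ### Growth of the moments from above -/

section UpperBound

variable {Ω : Type*} [MeasurableSpace Ω] {P : Measure Ω} [IsProbabilityMeasure P]
  {n : ℕ} [NeZero n] {θ τ lam : ℝ} {σ : ℝ → ℝ} {v₀ : ZMod n → ℝ} {η : ℕ → ZMod n → Ω → ℝ}

/-- The squared `L^p` norm of the linear functional `c` of the solution at time `i`, written as the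
`L^(p/2)` norm of the square. -/
noncomputable def sqNorm (P : Measure Ω) (θ τ lam : ℝ) (σ : ℝ → ℝ) (v₀ : ZMod n → ℝ)
    (η : ℕ → ZMod n → Ω → ℝ) (p : ℝ) (i : ℕ) (c : ZMod n → ℝ) : ℝ≥0∞ :=
  lpNorm P (p / 2) fun ω => ENNReal.ofReal ((c ⬝ᵥ noisePath θ τ lam σ v₀ η i ω) ^ 2)

lemma ofReal_rpow_half_sq (t p : ℝ) (hp : 2 ≤ p) :
    ENNReal.ofReal (t ^ 2) ^ (p / 2) = ENNReal.ofReal (|t| ^ p) := by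
  rw [ENNReal.ofReal_rpow_of_nonneg (sq_nonneg t) (by linarith), ← sq_abs, ← Real.rpow_natCast,
    ← Real.rpow_mul (abs_nonneg t)]
  congr 2; push_cast; ring

lemma sq_le_of_lipschitz {L : ℝ≥0} (hσ : LipschitzWith L σ) (x : ℝ) :
    σ x ^ 2 ≤ 2 * (σ 0 ^ 2 + L ^ 2 * x ^ 2) := by
  have h := hσ.dist_le_mul x 0
  rw [Real.dist_eq, Real.dist_eq, sub_zero] at h
  have h2 : (σ x - σ 0) ^ 2 ≤ (L * |x|) ^ 2 := by
    rw [← sq_abs]; exact pow_le_pow_left₀ (abs_nonneg _) h 2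
  rw [mul_pow, sq_abs] at h2
  nlinarith [sq_nonneg (σ x - 2 * σ 0)]

/-- One step of the moment recursion: conditionally Gaussian estimate, then Minkowski's inequality
in `L^(p/2)`. -/
lemma sqNorm_succ_le {L : ℝ≥0} (hη : IsStandardNoise P η) (hσ : LipschitzWith L σ) (hτ : 0 < τ)
    {p : ℝ} (hp : 2 ≤ p) (i : ℕ) (c : ZMod n → ℝ) :
    sqNorm P θ τ lam σ v₀ η p (i + 1) c
      ≤ sqNorm P θ τ lam σ v₀ η p i (mult (stepSymbol n θ τ) c)
        + ∑ k, ENNReal.ofReal (16 * p * (lam ^ 2 * τ * n) * mult (resolventSymbol n θ τ) c k ^ 2)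
          * (ENNReal.ofReal (σ 0 ^ 2) + ENNReal.ofReal ((L : ℝ) ^ 2)
            * sqNorm P θ τ lam σ v₀ η p i (Pi.single k 1)) := by
  have hr : 1 ≤ p / 2 := by linarith
  set V := noisePath θ τ lam σ v₀ η i with hV
  set c' := mult (stepSymbol n θ τ) c with hc'
  set b := mult (resolventSymbol n θ τ) c with hb
  have hdot : ∀ d : ZMod n → ℝ, AEMeasurable (fun ω => ENNReal.ofReal ((d ⬝ᵥ V ω) ^ 2)) P :=
    fun d => ((hη.aemeasurable_dotProduct hσ.continuous d i).pow_const 2).ennreal_ofReal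
  -- the bound `2 (σ(0)² + L² x²)` for `σ(x)²` turns the factor `8` of the Gaussian estimate into `16`
  have h1 : sqNorm P θ τ lam σ v₀ η p (i + 1) c ≤ lpNorm P (p / 2) fun ω =>
      ENNReal.ofReal ((c' ⬝ᵥ V ω) ^ 2) + ∑ k,
        ENNReal.ofReal (16 * p * (lam ^ 2 * τ * n) * b k ^ 2) * (ENNReal.ofReal (σ 0 ^ 2)
          + ENNReal.ofReal ((L : ℝ) ^ 2)
            * ENNReal.ofReal (((Pi.single k 1 : ZMod n → ℝ) ⬝ᵥ V ω) ^ 2)) := by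
    refine ENNReal.rpow_le_rpow ?_ (by positivity)
    simp only [ofReal_rpow_half_sq _ _ hp]
    rw [hη.lintegral_noisePath_succ hσ.continuous hτ c i
      (f := fun t => ENNReal.ofReal (|t| ^ p)) (by fun_prop)]
    refine lintegral_mono fun ω => ?_
    refine (lintegral_abs_add_rpow_gaussianReal_le hp _ _).trans ?_
    rw [← hV, ← hc', ← hb, Real.coe_toNNReal _ (by positivity),
      ← ENNReal.ofReal_rpow_of_nonneg (by positivity) (by linarith)]
    refine ENNReal.rpow_le_rpow ?_ (by linarith)
    rw [ENNReal.ofReal_add (by positivity) (by positivity)]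
    refine add_le_add_right ?_ _
    simp_rw [← ENNReal.ofReal_mul (sq_nonneg (L : ℝ))]
    have e : ∀ k : ZMod n, ENNReal.ofReal (σ 0 ^ 2) + ENNReal.ofReal ((L : ℝ) ^ 2
        * ((Pi.single k 1 : ZMod n → ℝ) ⬝ᵥ V ω) ^ 2)
        = ENNReal.ofReal (σ 0 ^ 2 + (L : ℝ) ^ 2 * (V ω k) ^ 2) := fun k => by
      rw [← ENNReal.ofReal_add (by positivity) (by positivity), single_one_dotProduct]
    have hnn : ∀ k : ZMod n, 0 ≤ 16 * p * (lam ^ 2 * τ * n) * b k ^ 2 := fun k => by positivity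
    simp_rw [e, ← ENNReal.ofReal_mul (hnn _)]
    rw [← ENNReal.ofReal_sum_of_nonneg fun k _ => mul_nonneg (hnn k) (by positivity)]
    refine ENNReal.ofReal_le_ofReal ?_
    rw [Finset.mul_sum, Finset.mul_sum]
    refine Finset.sum_le_sum fun k _ => ?_
    have h := mul_le_mul_of_nonneg_left (sq_le_of_lipschitz hσ (V ω k))
      (by positivity : 0 ≤ 8 * p * (lam ^ 2 * τ * n) * b k ^ 2)
    linarith
  refine h1.trans ?_
  have hterm : ∀ k : ZMod n, AEMeasurable (fun ω => ENNReal.ofReal (σ 0 ^ 2)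
      + ENNReal.ofReal ((L : ℝ) ^ 2)
        * ENNReal.ofReal (((Pi.single k 1 : ZMod n → ℝ) ⬝ᵥ V ω) ^ 2)) P :=
    fun k => aemeasurable_const.add ((hdot _).const_mul _)
  refine (lpNorm_add_le hr (hdot c')
    (Finset.aemeasurable_fun_sum _ fun k _ => (hterm k).const_mul _)).trans ?_
  refine add_le_add_right ?_ _
  refine (lpNorm_sum_le hr _ fun k => (hterm k).const_mul _).trans (Finset.sum_le_sum fun k _ => ?_)
  rw [lpNorm_const_mul hr (hterm k)]
  refine mul_le_mul_right ?_ _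
  refine (lpNorm_add_le hr aemeasurable_const ((hdot _).const_mul _)).trans ?_
  rw [lpNorm_const hr, lpNorm_const_mul hr (hdot _)]
  rfl

/-- Discrete Duhamel inequality for squared `L^p` norms. -/
lemma sqNorm_le_duhamel {L : ℝ≥0} (hη : IsStandardNoise P η) (hσ : LipschitzWith L σ)
    (hτ : 0 < τ) {p : ℝ} (hp : 2 ≤ p) (m : ℕ) (c : ZMod n → ℝ) :
    sqNorm P θ τ lam σ v₀ η p m c
      ≤ ENNReal.ofReal ((mult (stepSymbol n θ τ ^ m) c ⬝ᵥ v₀) ^ 2)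
        + ∑ i ∈ Finset.range m, ∑ k, ENNReal.ofReal (16 * p * (lam ^ 2 * τ * n)
            * mult (stepSymbol n θ τ ^ (m - 1 - i) * resolventSymbol n θ τ) c k ^ 2)
          * (ENNReal.ofReal (σ 0 ^ 2) + ENNReal.ofReal ((L : ℝ) ^ 2)
            * sqNorm P θ τ lam σ v₀ η p i (Pi.single k 1)) := by
  induction m generalizing c with
  | zero =>
    simp only [pow_zero, mult_one, Finset.range_zero, Finset.sum_empty, add_zero, sqNorm,
      noisePath, path]
    rw [lpNorm_const (by linarith)]
  | succ m ih =>
    refine (sqNorm_succ_le hη hσ hτ hp m c).trans ?_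
    rw [Finset.sum_range_succ, ← add_assoc]
    have e0 : m + 1 - 1 - m = 0 := by omega
    rw [e0, pow_zero, one_mul]
    refine add_le_add_left ((ih _).trans (le_of_eq ?_)) _
    have hS : Function.Even (stepSymbol n θ τ) := stepSymbol_even θ τ
    have hSm : Function.Even (stepSymbol n θ τ ^ m) := fun l => by simp [hS l]
    rw [mult_mult hSm hS, ← pow_succ]
    congr 1
    refine Finset.sum_congr rfl fun i hi => Finset.sum_congr rfl fun k _ => ?_
    have hi' : m - 1 - i + 1 = m + 1 - 1 - i := by have := Finset.mem_range.1 hi; omega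
    have e : stepSymbol n θ τ ^ (m - 1 - i) * resolventSymbol n θ τ * stepSymbol n θ τ
        = stepSymbol n θ τ ^ (m + 1 - 1 - i) * resolventSymbol n θ τ := by
      rw [← hi', pow_succ]; ring
    rw [mult_mult (stepSymbol_pow_mul_even θ τ (resolventSymbol_even θ τ) _) hS, e]

/-- The renewal inequality: if the discounted heat kernel is small compared with the noise, the
squared `L^p` norms grow at most like `exp (β t)`. -/
lemma exists_sqNorm_le_exp {L : ℝ≥0} (hη : IsStandardNoise P η) (hσ : LipschitzWith L σ)
    (hθ : 0 ≤ θ) (hτ : 0 < τ) (hstep : StepSizeCondition θ n τ) {p : ℝ} (hp : 2 ≤ p) {β : ℝ}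
    (hβ : 0 < β) (hsmall : 16 * p * lam ^ 2 * (3 / β + 12 / √β) * L ^ 2 ≤ 1 / 2) :
    ∃ M : ℝ, 0 < M ∧ ∀ (m : ℕ) (j : ZMod n),
      sqNorm P θ τ lam σ v₀ η p m (Pi.single j 1) ≤ ENNReal.ofReal (M * Real.exp (β * τ * m)) := by
  set q := 16 * p * lam ^ 2 * (3 / β + 12 / √β) with hq
  have hq0 : 0 ≤ q := by positivity
  set C₀ := (∑ k, |v₀ k|) ^ 2 with hC₀
  have hC₀' : 0 ≤ C₀ := sq_nonneg _
  set M := 2 * (C₀ + q * σ 0 ^ 2) + 1 with hM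
  have hM0 : 0 < M := by positivity
  refine ⟨M, hM0, fun m => ?_⟩
  induction m using Nat.strong_induction_on with
  | _ m ih =>
  intro j
  refine (sqNorm_le_duhamel hη hσ hτ hp m _).trans ?_
  set E := Real.exp (β * τ * m) with hE
  have hE1 : 1 ≤ E := Real.one_le_exp (by positivity)
  set g : ℕ → ZMod n → ℝ := fun i k =>
    kernel (stepSymbol n θ τ ^ i * resolventSymbol n θ τ) (k - j) ^ 2 with hg
  have hg0 : ∀ i k, 0 ≤ g i k := fun i k => sq_nonneg _
  have hinit : (mult (stepSymbol n θ τ ^ m) (Pi.single j 1) ⬝ᵥ v₀) ^ 2 ≤ C₀ := by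
    rw [← dotProduct_mult, single_one_dotProduct, hC₀, ← sq_abs]
    refine pow_le_pow_left₀ (abs_nonneg _) (abs_mult_le (fun l => ?_) _ _) 2
    rw [Pi.pow_apply, abs_pow]
    exact pow_le_one₀ (abs_nonneg _)
      ((sq_le_one_iff_abs_le_one _).1 (stepSymbol_sq_le_one hθ hτ hstep l))
  have hsum : ∑ i ∈ Finset.range m, ∑ k, ENNReal.ofReal (16 * p * (lam ^ 2 * τ * n)
            * mult (stepSymbol n θ τ ^ (m - 1 - i) * resolventSymbol n θ τ) (Pi.single j 1) k ^ 2)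
          * (ENNReal.ofReal (σ 0 ^ 2) + ENNReal.ofReal ((L : ℝ) ^ 2)
            * sqNorm P θ τ lam σ v₀ η p i (Pi.single k 1))
      ≤ ENNReal.ofReal (∑ i ∈ Finset.range m, ∑ k, 16 * p * (lam ^ 2 * τ * n) * g (m - 1 - i) k
          * (σ 0 ^ 2 + (L : ℝ) ^ 2 * (M * Real.exp (β * τ * i)))) := by
    rw [ENNReal.ofReal_sum_of_nonneg fun i _ => Finset.sum_nonneg fun k _ => by
      have := hg0 (m - 1 - i) k; positivity]
    refine Finset.sum_le_sum fun i hi => ?_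
    rw [ENNReal.ofReal_sum_of_nonneg fun k _ => by have := hg0 (m - 1 - i) k; positivity]
    refine Finset.sum_le_sum fun k _ => ?_
    rw [mult_single, ENNReal.ofReal_mul (p := 16 * p * (lam ^ 2 * τ * n) * g (m - 1 - i) k)
        (by have := hg0 (m - 1 - i) k; positivity),
      ENNReal.ofReal_add (by positivity) (by positivity),
      ENNReal.ofReal_mul (p := (L : ℝ) ^ 2) (by positivity)]
    gcongr
    exact ih i (Finset.mem_range.1 hi) k
  have hreal : ∑ i ∈ Finset.range m, ∑ k, 16 * p * (lam ^ 2 * τ * n) * g (m - 1 - i) k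
          * (σ 0 ^ 2 + (L : ℝ) ^ 2 * (M * Real.exp (β * τ * i)))
      ≤ q * (σ 0 ^ 2 + L ^ 2 * M) * E := by
    -- multiplying and dividing by `E = exp (β τ m)` discounts the kernel over the elapsed time
    calc _ ≤ ∑ i ∈ Finset.range m, 16 * p * lam ^ 2 * (σ 0 ^ 2 + L ^ 2 * M) * E
            * (τ * ((n * ∑ k, g (m - 1 - i) k)
              * Real.exp (-(β * τ * ((m - 1 - i : ℕ) + 1))))) := by
          refine Finset.sum_le_sum fun i hi => ?_
          have hi' := Finset.mem_range.1 hi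
          have hcast : ((m - 1 - i : ℕ) : ℝ) + 1 = m - i := by
            have : m - 1 - i + 1 + i = m := by omega
            have : ((m - 1 - i : ℕ) : ℝ) + 1 + i = m := by exact_mod_cast this
            linarith
          have hexp : E * Real.exp (-(β * τ * ((m - 1 - i : ℕ) + 1)))
              = Real.exp (β * τ * i) := by
            rw [hcast, hE, ← Real.exp_add]; congr 1; ring
          have hi1 : 1 ≤ Real.exp (β * τ * i) := Real.one_le_exp (by positivity)
          rw [← Finset.sum_mul, ← Finset.mul_sum]
          have hG : 0 ≤ ∑ k, g (m - 1 - i) k := Finset.sum_nonneg fun k _ => hg0 _ k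
          calc _ ≤ 16 * p * (lam ^ 2 * τ * n) * (∑ k, g (m - 1 - i) k)
                * ((σ 0 ^ 2 + L ^ 2 * M) * Real.exp (β * τ * i)) := by
                refine mul_le_mul_of_nonneg_left ?_ (by positivity)
                nlinarith [mul_le_mul_of_nonneg_left hi1 (sq_nonneg (σ 0))]
            _ = _ := by rw [← hexp]; ring
      _ = 16 * p * lam ^ 2 * (σ 0 ^ 2 + L ^ 2 * M) * E
            * (τ * ∑ i ∈ Finset.range m, (n * ∑ k, g i k) * Real.exp (-(β * τ * (i + 1)))) := by
          rw [← Finset.mul_sum, ← Finset.mul_sum,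
            Finset.sum_range_reflect (fun i : ℕ => (n * ∑ k, g i k)
              * Real.exp (-(β * τ * ((i : ℝ) + 1)))) m]
      _ ≤ 16 * p * lam ^ 2 * (σ 0 ^ 2 + L ^ 2 * M) * E * (3 / β + 12 / √β) :=
          mul_le_mul_of_nonneg_left (tau_mul_sum_kernel_sq_le hθ hτ hstep hβ j m) (by positivity)
      _ = _ := by rw [hq]; ring
  refine (add_le_add (ENNReal.ofReal_le_ofReal hinit)
    (hsum.trans (ENNReal.ofReal_le_ofReal hreal))).trans ?_
  rw [← ENNReal.ofReal_add hC₀' (by positivity)]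
  refine ENNReal.ofReal_le_ofReal ?_
  have h1 : q * (σ 0 ^ 2 + L ^ 2 * M) ≤ q * σ 0 ^ 2 + 1 / 2 * M := by
    nlinarith [mul_le_mul_of_nonneg_right hsmall hM0.le]
  have h2 := mul_le_mul_of_nonneg_right h1 (by linarith : 0 ≤ E)
  have h3 := mul_le_mul_of_nonneg_left hE1 hC₀'
  nlinarith

/-- Exponential moment bound at the grid points. -/
lemma exists_lintegral_noisePath_le_exp {L : ℝ≥0} (hη : IsStandardNoise P η)
    (hσ : LipschitzWith L σ)
    (hθ : 0 ≤ θ) (hτ : 0 < τ) (hstep : StepSizeCondition θ n τ) {p : ℝ} (hp : 2 ≤ p) {β : ℝ}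
    (hβ : 0 < β) (hsmall : 16 * p * lam ^ 2 * (3 / β + 12 / √β) * L ^ 2 ≤ 1 / 2) :
    ∃ M : ℝ, 0 < M ∧ ∀ (m : ℕ) (j : ZMod n),
      ∫⁻ ω, ‖noisePath θ τ lam σ v₀ η m ω j‖ₑ ^ p ∂P
        ≤ ENNReal.ofReal (M * Real.exp (β * p / 2 * τ * m)) := by
  obtain ⟨M, hM, h⟩ := exists_sqNorm_le_exp (lam := lam) (v₀ := v₀) hη hσ hθ hτ hstep hp hβ hsmall
  have hp0 : 0 < p / 2 := by linarith
  refine ⟨M ^ (p / 2), by positivity, fun m j => ?_⟩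
  have h1 := ENNReal.rpow_le_rpow (h m j) hp0.le
  rw [sqNorm, lpNorm, ← ENNReal.rpow_mul, one_div_mul_cancel hp0.ne', ENNReal.rpow_one,
    ENNReal.ofReal_rpow_of_nonneg (by positivity) hp0.le,
    Real.mul_rpow hM.le (Real.exp_pos _).le, ← Real.exp_mul] at h1
  have e : ∀ t : ℝ, ‖t‖ₑ ^ p = ENNReal.ofReal (t ^ 2) ^ (p / 2) := fun t => by
    rw [ofReal_rpow_half_sq _ _ hp, Real.enorm_eq_ofReal_abs,
      ENNReal.ofReal_rpow_of_nonneg (abs_nonneg _) (by linarith)]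
  simp only [e]
  simp only [single_one_dotProduct] at h1
  refine h1.trans (le_of_eq ?_)
  congr 3; ring

end UpperBound

/-! ### Growth of the second moment from below -/

section LowerBound

variable {Ω : Type*} [MeasurableSpace Ω] {P : Measure Ω}
  {n : ℕ} [NeZero n] {θ τ lam : ℝ} {σ : ℝ → ℝ} {v₀ : ZMod n → ℝ} {η : ℕ → ZMod n → Ω → ℝ}

/-- The second moment of the linear functional `c` of the solution at time `i`. -/
noncomputable def secondMoment (P : Measure Ω) (θ τ lam : ℝ) (σ : ℝ → ℝ) (v₀ : ZMod n → ℝ)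
    (η : ℕ → ZMod n → Ω → ℝ) (i : ℕ) (c : ZMod n → ℝ) : ℝ≥0∞ :=
  ∫⁻ ω, ENNReal.ofReal ((c ⬝ᵥ noisePath θ τ lam σ v₀ η i ω) ^ 2) ∂P

/-- By the Cauchy-Schwarz inequality the zero mode is controlled by the individual grid points. -/
lemma secondMoment_mean_le (hη : IsStandardNoise P η) (hσ : Continuous σ) (i : ℕ) :
    secondMoment P θ τ lam σ v₀ η i (fun _ => (n : ℝ)⁻¹)
      ≤ ENNReal.ofReal (n : ℝ)⁻¹ * ∑ k, secondMoment P θ τ lam σ v₀ η i (Pi.single k 1) := by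
  have hn : (n : ℝ) ≠ 0 := Nat.cast_ne_zero.2 (NeZero.ne n)
  set V := noisePath θ τ lam σ v₀ η i with hV
  have hdot : ∀ d : ZMod n → ℝ, AEMeasurable (fun ω => ENNReal.ofReal ((d ⬝ᵥ V ω) ^ 2)) P :=
    fun d => ((hη.aemeasurable_dotProduct hσ d i).pow_const 2).ennreal_ofReal
  simp only [secondMoment]
  rw [← lintegral_finsetSum' _ fun k _ => hdot _,
    ← lintegral_const_mul'' _ (Finset.aemeasurable_fun_sum _ fun k _ => hdot _)]
  refine lintegral_mono fun ω => ?_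
  simp only [single_one_dotProduct]
  rw [← ENNReal.ofReal_sum_of_nonneg fun k _ => sq_nonneg _, ← ENNReal.ofReal_mul (by positivity)]
  refine ENNReal.ofReal_le_ofReal ?_
  rw [← hV, dotProduct, ← Finset.mul_sum]
  have h := sq_sum_le_card_mul_sum_sq (s := Finset.univ) (f := V ω)
  rw [Finset.card_univ, ZMod.card] at h
  calc ((n : ℝ)⁻¹ * ∑ k, V ω k) ^ 2 = (n : ℝ)⁻¹ ^ 2 * (∑ k, V ω k) ^ 2 := by ring
    _ ≤ (n : ℝ)⁻¹ ^ 2 * (n * ∑ k, V ω k ^ 2) := mul_le_mul_of_nonneg_left h (by positivity)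
    _ = (n : ℝ)⁻¹ * ∑ k, V ω k ^ 2 := by field_simp

variable [IsProbabilityMeasure P]

lemma le_secondMoment_succ (hη : IsStandardNoise P η) (hσ : Continuous σ) (hτ : 0 < τ) {J : ℝ}
    (hJ : ∀ x, J ^ 2 * x ^ 2 ≤ σ x ^ 2) (i : ℕ) (c : ZMod n → ℝ) :
    secondMoment P θ τ lam σ v₀ η i (mult (stepSymbol n θ τ) c)
        + ENNReal.ofReal (lam ^ 2 * τ * n * J ^ 2)
          * ∑ k, ENNReal.ofReal (mult (resolventSymbol n θ τ) c k ^ 2)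
            * secondMoment P θ τ lam σ v₀ η i (Pi.single k 1)
      ≤ secondMoment P θ τ lam σ v₀ η (i + 1) c := by
  set V := noisePath θ τ lam σ v₀ η i with hV
  have hdot : ∀ d : ZMod n → ℝ, AEMeasurable (fun ω => ENNReal.ofReal ((d ⬝ᵥ V ω) ^ 2)) P :=
    fun d => ((hη.aemeasurable_dotProduct hσ d i).pow_const 2).ennreal_ofReal
  simp only [secondMoment]
  rw [hη.lintegral_noisePath_succ hσ hτ c i (f := fun t => ENNReal.ofReal (t ^ 2)) (by fun_prop)]
  simp only [← hV, lintegral_add_sq_gaussianReal]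
  have e : ∀ k, ENNReal.ofReal (mult (resolventSymbol n θ τ) c k ^ 2)
      * ∫⁻ ω, ENNReal.ofReal (((Pi.single k 1 : ZMod n → ℝ) ⬝ᵥ V ω) ^ 2) ∂P
      = ∫⁻ ω, ENNReal.ofReal (mult (resolventSymbol n θ τ) c k ^ 2)
      * ENNReal.ofReal (((Pi.single k 1 : ZMod n → ℝ) ⬝ᵥ V ω) ^ 2) ∂P := fun k =>
    (lintegral_const_mul'' _ (hdot _)).symm
  simp only [e]
  rw [← lintegral_finsetSum' _ fun k _ => (hdot _).const_mul _,
    ← lintegral_const_mul'' _ (Finset.aemeasurable_fun_sum _ fun k _ => (hdot _).const_mul _),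
    ← lintegral_add_left' (hdot _)]
  refine lintegral_mono fun ω => ?_
  simp only [single_one_dotProduct]
  simp_rw [← ENNReal.ofReal_mul (sq_nonneg (mult (resolventSymbol n θ τ) c _))]
  rw [← ENNReal.ofReal_sum_of_nonneg fun k _ => by positivity,
    ← ENNReal.ofReal_mul (by positivity), ← ENNReal.ofReal_add (by positivity) (by positivity),
    Real.coe_toNNReal _ (by positivity)]
  refine ENNReal.ofReal_le_ofReal (add_le_add_right ?_ _)
  rw [mul_assoc (lam ^ 2 * τ * n) (J ^ 2)]
  refine mul_le_mul_of_nonneg_left ?_ (by positivity)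
  rw [Finset.mul_sum]
  refine Finset.sum_le_sum fun k _ => ?_
  nlinarith [mul_le_mul_of_nonneg_left (hJ (V ω k))
    (sq_nonneg (mult (resolventSymbol n θ τ) c k))]

/-- The zero Fourier mode is a martingale whose second moment grows at least geometrically. -/
lemma le_secondMoment_mean (hη : IsStandardNoise P η) (hσ : Continuous σ) (hτ : 0 < τ) {J : ℝ}
    (hJ : ∀ x, J ^ 2 * x ^ 2 ≤ σ x ^ 2) {I₀ : ℝ} (hI : 0 ≤ I₀) (hv₀ : ∀ k, I₀ ≤ v₀ k) (i : ℕ) :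
    ENNReal.ofReal (I₀ ^ 2 * (1 + lam ^ 2 * J ^ 2 * τ) ^ i)
      ≤ secondMoment P θ τ lam σ v₀ η i (fun _ => (n : ℝ)⁻¹) := by
  have hn : (0 : ℝ) < n := Nat.cast_pos.2 (NeZero.pos n)
  induction i with
  | zero =>
    simp only [secondMoment, noisePath, path, lintegral_const, measure_univ, mul_one, pow_zero]
    refine ENNReal.ofReal_le_ofReal (pow_le_pow_left₀ hI ?_ 2)
    rw [dotProduct, ← Finset.mul_sum, le_inv_mul_iff₀ hn]
    have := Finset.sum_le_sum fun k (_ : k ∈ Finset.univ) => hv₀ k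
    simpa using this
  | succ i ih =>
    refine le_trans ?_ (le_secondMoment_succ hη hσ hτ hJ i _)
    have e1 : mult (stepSymbol n θ τ) (fun _ => (n : ℝ)⁻¹) = fun _ => (n : ℝ)⁻¹ := by
      ext j; rw [mult_const (stepSymbol_even θ τ), stepSymbol_zero, one_mul]
    have e2 : ∀ k, mult (resolventSymbol n θ τ) (fun _ => (n : ℝ)⁻¹) k = (n : ℝ)⁻¹ := fun k => by
      rw [mult_const (resolventSymbol_even θ τ), resolventSymbol_zero, one_mul]
    simp only [e1, e2]
    rw [← Finset.mul_sum, ← mul_assoc, ← ENNReal.ofReal_mul (by positivity)]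
    have e3 : lam ^ 2 * τ * n * J ^ 2 * (n : ℝ)⁻¹ ^ 2 = lam ^ 2 * J ^ 2 * τ * (n : ℝ)⁻¹ := by
      field_simp
    rw [e3, ENNReal.ofReal_mul (p := lam ^ 2 * J ^ 2 * τ) (by positivity),
      mul_assoc (ENNReal.ofReal _)]
    calc ENNReal.ofReal (I₀ ^ 2 * (1 + lam ^ 2 * J ^ 2 * τ) ^ (i + 1))
        = ENNReal.ofReal (I₀ ^ 2 * (1 + lam ^ 2 * J ^ 2 * τ) ^ i)
          + ENNReal.ofReal (lam ^ 2 * J ^ 2 * τ)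
            * ENNReal.ofReal (I₀ ^ 2 * (1 + lam ^ 2 * J ^ 2 * τ) ^ i) := by
          rw [← ENNReal.ofReal_mul (by positivity),
            ← ENNReal.ofReal_add (by positivity) (by positivity)]
          congr 1; ring
      _ ≤ _ := by
          gcongr
          exact ih.trans (secondMoment_mean_le hη hσ i)

lemma secondMoment_mult_pow_le (hη : IsStandardNoise P η) (hσ : Continuous σ) (hτ : 0 < τ)
    (i l : ℕ) (c : ZMod n → ℝ) :
    secondMoment P θ τ lam σ v₀ η i (mult (stepSymbol n θ τ ^ l) c)
      ≤ secondMoment P θ τ lam σ v₀ η (i + l) c := by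
  induction l generalizing c with
  | zero => rw [pow_zero, mult_one, add_zero]
  | succ l ih =>
    have hS : Function.Even (stepSymbol n θ τ) := stepSymbol_even θ τ
    have hSl : Function.Even (stepSymbol n θ τ ^ l) := fun k => by simp [hS k]
    rw [pow_succ, ← mult_mult hSl hS]
    refine (ih _).trans (le_trans ?_ (le_secondMoment_succ (J := 0) hη hσ hτ
      (fun x => by simpa using sq_nonneg (σ x)) (i + l) c))
    exact le_self_add

/-- Mixing carries the growth of the zero mode over to every averaging functional `c`. -/
lemma exists_le_secondMoment (hη : IsStandardNoise P η) (hσ : Continuous σ) (hθ : 0 ≤ θ)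
    (hτ : 0 < τ) (hstep : StepSizeCondition θ n τ) (hlam : 0 < lam) {J : ℝ} (hJ0 : 0 < J)
    (hJ : ∀ x, J ^ 2 * x ^ 2 ≤ σ x ^ 2) {I₀ : ℝ} (hI : 0 < I₀) (hv₀ : ∀ k, I₀ ≤ v₀ k)
    {c : ZMod n → ℝ} (hc : ∑ k, c k = 1) :
    ∃ (K : ℝ) (l : ℕ), 0 < K ∧ ∀ m, l ≤ m →
      ENNReal.ofReal (K * (1 + lam ^ 2 * J ^ 2 * τ) ^ m)
        ≤ secondMoment P θ τ lam σ v₀ η m c := by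
  have hn : (0 : ℝ) < n := Nat.cast_pos.2 (NeZero.pos n)
  set G := 1 + lam ^ 2 * J ^ 2 * τ with hG
  have hG0 : 0 < G := by positivity
  -- after `l` steps the kernel started from `c` exceeds half of its limit `1 / n` everywhere
  have hev : ∀ᶠ l : ℕ in atTop, ∀ k : ZMod n, (2 * (n : ℝ))⁻¹
      ≤ mult (stepSymbol n θ τ ^ l * resolventSymbol n θ τ) c k := by
    rw [eventually_all]
    intro k
    have h := tendsto_mult_stepSymbol_pow hθ hτ hstep c k
    rw [hc, mul_one] at h
    refine (h.eventually_const_lt ?_).mono fun l hl => hl.le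
    exact (inv_lt_inv₀ (by positivity) hn).2 (by linarith)
  obtain ⟨l, hl⟩ := hev.exists
  refine ⟨lam ^ 2 * τ * n * J ^ 2 * ((2 * (n : ℝ))⁻¹ ^ 2 * (n * I₀ ^ 2)) / G ^ (1 + l), 1 + l,
    by positivity, fun m hm => ?_⟩
  obtain ⟨i, rfl⟩ := Nat.exists_eq_add_of_le' hm
  rw [← add_assoc]
  refine le_trans ?_ (secondMoment_mult_pow_le hη hσ hτ (i + 1) l c)
  refine le_trans ?_ (le_secondMoment_succ hη hσ hτ hJ i _)
  refine le_trans ?_ le_add_self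
  have hS : Function.Even (stepSymbol n θ τ) := stepSymbol_even θ τ
  have hSl : Function.Even (stepSymbol n θ τ ^ l) := fun k => by simp [hS k]
  rw [mult_mult (resolventSymbol_even θ τ) hSl, mul_comm (resolventSymbol n θ τ)]
  have hsum : ENNReal.ofReal (n * I₀ ^ 2 * G ^ i)
      ≤ ∑ k, secondMoment P θ τ lam σ v₀ η i (Pi.single k 1) := by
    have h := (le_secondMoment_mean (θ := θ) (lam := lam) hη hσ hτ hJ hI.le hv₀ i).trans
      (secondMoment_mean_le hη hσ i)
    have h' := mul_le_mul_right h (ENNReal.ofReal n)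
    rw [← mul_assoc, ← ENNReal.ofReal_mul hn.le, ← ENNReal.ofReal_mul hn.le,
      mul_inv_cancel₀ hn.ne', ENNReal.ofReal_one, one_mul, ← mul_assoc] at h'
    exact h'
  calc ENNReal.ofReal (lam ^ 2 * τ * n * J ^ 2 * ((2 * (n : ℝ))⁻¹ ^ 2 * (n * I₀ ^ 2))
        / G ^ (1 + l) * G ^ (i + 1 + l))
      = ENNReal.ofReal (lam ^ 2 * τ * n * J ^ 2) * (ENNReal.ofReal ((2 * (n : ℝ))⁻¹ ^ 2)
        * ENNReal.ofReal (n * I₀ ^ 2 * G ^ i)) := by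
        rw [← ENNReal.ofReal_mul (by positivity), ← ENNReal.ofReal_mul (by positivity),
          add_assoc i, pow_add G i]
        congr 1
        field_simp
    _ ≤ ENNReal.ofReal (lam ^ 2 * τ * n * J ^ 2) * (ENNReal.ofReal ((2 * (n : ℝ))⁻¹ ^ 2)
        * ∑ k, secondMoment P θ τ lam σ v₀ η i (Pi.single k 1)) := by gcongr
    _ ≤ _ := by
        rw [Finset.mul_sum]
        gcongr with k _
        exact hl k

end LowerBound

/-! ### Lyapunov exponents from exponential bounds -/

section Lyapunov

variable {Ω : Type*} [MeasurableSpace Ω] {P : Measure Ω}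

lemma tendsto_log_exp_div {τ M : ℝ} (hτ : 0 < τ) (hM : 0 < M) (B : ℝ) :
    Tendsto (fun m : ℕ => ENNReal.log (ENNReal.ofReal (M * Real.exp (B * τ * m)))
      / (((m : ℝ) * τ : ℝ) : EReal)) atTop (𝓝 (B : EReal)) := by
  have h1 : ∀ m : ℕ, ENNReal.log (ENNReal.ofReal (M * Real.exp (B * τ * m)))
      / (((m : ℝ) * τ : ℝ) : EReal) = (((Real.log M + B * τ * m) / (m * τ) : ℝ) : EReal) :=
    fun m => by
      rw [ENNReal.log_ofReal_of_pos (by positivity), Real.log_mul hM.ne' (Real.exp_pos _).ne',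
        Real.log_exp, ← EReal.coe_div]
  simp only [h1]
  refine (continuous_coe_real_ereal.tendsto B).comp ?_
  have h2 : Tendsto (fun m : ℕ => Real.log M / τ / (m : ℝ) + B) atTop (𝓝 (0 + B)) :=
    (tendsto_const_div_atTop_nhds_zero_nat _).add_const B
  rw [zero_add] at h2
  refine h2.congr' ?_
  filter_upwards [eventually_gt_atTop 0] with m hm
  have hm' : (0 : ℝ) < m := Nat.cast_pos.2 hm
  field_simp

lemma upperLyapunov_le {τ M B p x : ℝ} {v : ℕ → ℝ → Ω → ℝ} (hτ : 0 < τ) (hM : 0 < M)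
    (h : ∀ m, ∫⁻ ω, ‖v m x ω‖ₑ ^ p ∂P ≤ ENNReal.ofReal (M * Real.exp (B * τ * m))) :
    upperLyapunov P τ v p x ≤ B := by
  rw [← (tendsto_log_exp_div hτ hM B).limsup_eq]
  refine limsup_le_limsup (Eventually.of_forall fun m => ?_)
  refine EReal.div_le_div_right_of_nonneg (by exact_mod_cast (by positivity)) ?_
  exact ENNReal.log_monotone (h m)

lemma le_upperLyapunov {τ K B p x : ℝ} {v : ℕ → ℝ → Ω → ℝ} (hτ : 0 < τ) (hK : 0 < K) {l : ℕ}
    (h : ∀ m, l ≤ m → ENNReal.ofReal (K * Real.exp (B * τ * m)) ≤ ∫⁻ ω, ‖v m x ω‖ₑ ^ p ∂P) :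
    B ≤ upperLyapunov P τ v p x := by
  rw [← (tendsto_log_exp_div hτ hK B).limsup_eq]
  refine limsup_le_limsup ?_
  filter_upwards [eventually_ge_atTop l] with m hm
  refine EReal.div_le_div_right_of_nonneg (by exact_mod_cast (by positivity)) ?_
  exact ENNReal.log_monotone (h m hm)

end Lyapunov

/-! ### Linear interpolation -/

section Interpolation

variable {Ω : Type*} {n : ℕ} [NeZero n]

lemma noise_term_eq {W : ℝ → ℝ → Ω → ℝ} {τ lam : ℝ} (hτ : 0 < τ) (s : ℝ) (i : ℕ) (j : ZMod n)
    (ω : Ω) :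
    lam * √(τ * n) * s * stdNoise n τ W i j ω = lam * τ * s * noiseIncrement n τ W i j ω := by
  have hn : (0 : ℝ) < n := Nat.cast_pos.2 (NeZero.pos n)
  have h : √(τ * n) * √(τ / n) = τ := by
    rw [← Real.sqrt_mul (by positivity), show τ * n * (τ / n) = τ * τ by field_simp,
      Real.sqrt_mul_self hτ.le]
  rw [stdNoise]
  linear_combination (lam * s * noiseIncrement n τ W i j ω) * h

/-- The coefficients of linear interpolation at `x` in terms of the grid values. -/
noncomputable def interpCoeff (n : ℕ) (x : ℝ) : ZMod n → ℝ :=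
  (1 - Int.fract ((n : ℝ) * x)) • Pi.single (⌊(n : ℝ) * x⌋ : ZMod n) 1
    + Int.fract ((n : ℝ) * x) • Pi.single ((⌊(n : ℝ) * x⌋ : ZMod n) + 1) 1

lemma interpCoeff_dotProduct (x : ℝ) (v : ZMod n → ℝ) :
    interpCoeff n x ⬝ᵥ v = (1 - Int.fract ((n : ℝ) * x)) * v (⌊(n : ℝ) * x⌋ : ZMod n)
      + Int.fract ((n : ℝ) * x) * v ((⌊(n : ℝ) * x⌋ : ZMod n) + 1) := by
  simp [interpCoeff, add_dotProduct]

lemma sum_interpCoeff (x : ℝ) : ∑ k, interpCoeff n x k = 1 := by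
  have h := interpCoeff_dotProduct (n := n) x (fun _ => 1)
  simp only [dotProduct, mul_one] at h
  rw [h]; ring

lemma interpolate_eq_dotProduct (U : ℕ → ZMod n → Ω → ℝ) (i : ℕ) (x : ℝ) (ω : Ω) :
    interpolate n U i x ω = interpCoeff n x ⬝ᵥ fun j => U i j ω := by
  rw [interpCoeff_dotProduct, interpolate, Int.fract]; ring

lemma enorm_convex_comb_rpow_le {s p : ℝ} (hs0 : 0 ≤ s) (hs1 : s ≤ 1) (hp : 0 ≤ p) (a b : ℝ) :
    ‖(1 - s) * a + s * b‖ₑ ^ p ≤ ‖a‖ₑ ^ p + ‖b‖ₑ ^ p := by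
  have h1 : |(1 - s) * a + s * b| ≤ max |a| |b| := by
    refine (abs_add_le _ _).trans ?_
    rw [abs_mul, abs_mul, abs_of_nonneg hs0, abs_of_nonneg (sub_nonneg.2 hs1)]
    nlinarith [le_max_left |a| |b|, le_max_right |a| |b|]
  rcases le_total |a| |b| with h | h
  · rw [max_eq_right h] at h1
    exact (ENNReal.rpow_le_rpow (enorm_le_iff_norm_le.2 h1) hp).trans le_add_self
  · rw [max_eq_left h] at h1
    exact (ENNReal.rpow_le_rpow (enorm_le_iff_norm_le.2 h1) hp).trans le_self_add

end Interpolation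

/-! ### Solutions of the scheme and their exponents -/

section Solutions

variable {Ω : Type*} [MeasurableSpace Ω] {P : Measure Ω} {W : ℝ → ℝ → Ω → ℝ}
  {n : ℕ} [NeZero n] {θ τ lam : ℝ} {σ u₀ : ℝ → ℝ}

lemma isSolution_noisePath (hθ : 0 ≤ θ) (hτ : 0 < τ) :
    IsSolution P W θ lam σ u₀ n τ (fun i j ω => noisePath θ τ lam σ
      (fun k => u₀ (gridPoint n k)) (stdNoise n τ W) i ω j) := by
  refine ⟨Eventually.of_forall fun ω j => rfl, Eventually.of_forall fun ω i j => ?_⟩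
  rw [← noise_term_eq hτ]
  exact (scheme_iff hθ hτ _ _ (fun k => lam * √(τ * n) * σ (noisePath θ τ lam σ
    (fun k => u₀ (gridPoint n k)) (stdNoise n τ W) i ω k) * stdNoise n τ W i k ω)).2 rfl j

lemma IsSolution.ae_eq_noisePath {U : ℕ → ZMod n → Ω → ℝ}
    (hU : IsSolution P W θ lam σ u₀ n τ U) (hθ : 0 ≤ θ) (hτ : 0 < τ) :
    ∀ᵐ ω ∂P, ∀ i j, U i j ω = noisePath θ τ lam σ (fun k => u₀ (gridPoint n k))
      (stdNoise n τ W) i ω j := by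
  filter_upwards [hU.initial, hU.step] with ω h0 h1 i
  induction i with
  | zero => exact h0
  | succ i ih =>
    have ih' : (fun j => U i j ω) = noisePath θ τ lam σ (fun k => u₀ (gridPoint n k))
      (stdNoise n τ W) i ω := funext ih
    have h := (scheme_iff hθ hτ (fun j => U i j ω) (fun j => U (i + 1) j ω)
      (fun j => lam * √(τ * n) * σ (U i j ω) * stdNoise n τ W i j ω)).1
      fun j => by rw [noise_term_eq hτ]; exact h1 i j
    intro j
    refine (congrFun h j).trans ?_
    rw [noisePath, path, stepMap, ← noisePath, ← ih']

lemma IsSolution.lintegral_interpolate {U : ℕ → ZMod n → Ω → ℝ}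
    (hU : IsSolution P W θ lam σ u₀ n τ U) (hθ : 0 ≤ θ) (hτ : 0 < τ) (p x : ℝ) (m : ℕ) :
    ∫⁻ ω, ‖interpolate n U m x ω‖ₑ ^ p ∂P = ∫⁻ ω, ‖interpCoeff n x ⬝ᵥ noisePath θ τ lam σ
      (fun k => u₀ (gridPoint n k)) (stdNoise n τ W) m ω‖ₑ ^ p ∂P := by
  refine lintegral_congr_ae ?_
  filter_upwards [hU.ae_eq_noisePath hθ hτ] with ω h
  rw [interpolate_eq_dotProduct, show (fun j => U m j ω) = noisePath θ τ lam σ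
      (fun k => u₀ (gridPoint n k)) (stdNoise n τ W) m ω from funext (h m)]

variable [IsProbabilityMeasure P]

lemma IsSolution.upperLyapunov_le (hW : IsBrownianSheet P W) {U : ℕ → ZMod n → Ω → ℝ}
    (hU : IsSolution P W θ lam σ u₀ n τ U) {L : ℝ≥0} (hσ : LipschitzWith L σ) (hθ : 0 ≤ θ)
    (hτ : 0 < τ) (hstep : StepSizeCondition θ n τ) {p : ℝ} (hp : 2 ≤ p) {β : ℝ} (hβ : 0 < β)
    (hsmall : 16 * p * lam ^ 2 * (3 / β + 12 / √β) * L ^ 2 ≤ 1 / 2) (x : ℝ) :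
    upperLyapunov P τ (interpolate n U) p x ≤ ((β * p / 2 : ℝ) : EReal) := by
  have hη : IsStandardNoise P (stdNoise n τ W) := hW.isStandardNoise hτ
  obtain ⟨M, hM, h⟩ := exists_lintegral_noisePath_le_exp (lam := lam)
    (v₀ := fun k => u₀ (gridPoint n k)) hη hσ hθ hτ hstep hp hβ hsmall
  refine ThetaScheme.upperLyapunov_le (M := 2 * M) hτ (by positivity) fun m => ?_
  rw [hU.lintegral_interpolate hθ hτ]
  have hmeas : ∀ j, AEMeasurable (fun ω => ‖noisePath θ τ lam σ (fun k => u₀ (gridPoint n k))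
      (stdNoise n τ W) m ω j‖ₑ ^ p) P := fun j => ((measurable_pi_apply j).comp_aemeasurable
    (hη.aemeasurable_noisePath (θ := θ) (τ := τ) (lam := lam)
    (v₀ := fun k => u₀ (gridPoint n k)) hσ.continuous m)).enorm.pow_const p
  calc _ ≤ ∫⁻ ω, ‖noisePath θ τ lam σ (fun k => u₀ (gridPoint n k)) (stdNoise n τ W) m ω
          (⌊(n : ℝ) * x⌋ : ZMod n)‖ₑ ^ p + ‖noisePath θ τ lam σ (fun k => u₀ (gridPoint n k))
          (stdNoise n τ W) m ω ((⌊(n : ℝ) * x⌋ : ZMod n) + 1)‖ₑ ^ p ∂P := by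
        refine lintegral_mono fun ω => ?_
        rw [interpCoeff_dotProduct]
        exact enorm_convex_comb_rpow_le (Int.fract_nonneg _) (Int.fract_lt_one _).le
          (by linarith) _ _
    _ ≤ ENNReal.ofReal (M * Real.exp (β * p / 2 * τ * m))
          + ENNReal.ofReal (M * Real.exp (β * p / 2 * τ * m)) := by
        rw [lintegral_add_left' (hmeas _)]
        exact add_le_add (h m _) (h m _)
    _ = _ := by
        rw [← ENNReal.ofReal_add (by positivity) (by positivity)]; congr 1; ring

lemma IsSolution.le_upperLyapunov (hW : IsBrownianSheet P W) {U : ℕ → ZMod n → Ω → ℝ}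
    (hU : IsSolution P W θ lam σ u₀ n τ U) (hσ : Continuous σ) (hθ : 0 ≤ θ) (hτ : 0 < τ)
    (hstep : StepSizeCondition θ n τ) (hlam : 0 < lam) {J : ℝ} (hJ0 : 0 < J)
    (hJ : ∀ x, J ^ 2 * x ^ 2 ≤ σ x ^ 2) {I₀ : ℝ} (hI : 0 < I₀)
    (hu₀ : ∀ k : ZMod n, I₀ ≤ u₀ (gridPoint n k)) (x : ℝ) :
    ((Real.log (1 + lam ^ 2 * J ^ 2 * τ) / τ : ℝ) : EReal)
      ≤ upperLyapunov P τ (interpolate n U) 2 x := by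
  obtain ⟨K, l, hK, h⟩ := exists_le_secondMoment (lam := lam) (hW.isStandardNoise hτ) hσ hθ hτ
    hstep hlam hJ0 hJ hI hu₀ (sum_interpCoeff x)
  refine ThetaScheme.le_upperLyapunov hτ hK (l := l) fun m hm => ?_
  rw [hU.lintegral_interpolate hθ hτ]
  have e1 : Real.exp (Real.log (1 + lam ^ 2 * J ^ 2 * τ) / τ * τ * m)
      = (1 + lam ^ 2 * J ^ 2 * τ) ^ m := by
    rw [div_mul_cancel₀ _ hτ.ne', mul_comm, Real.exp_nat_mul, Real.exp_log (by positivity)]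
  rw [e1]
  refine (h m hm).trans (le_of_eq (lintegral_congr fun ω => ?_))
  rw [Real.enorm_eq_ofReal_abs, ENNReal.ofReal_rpow_of_nonneg (abs_nonneg _) (by norm_num),
    Real.rpow_two, sq_abs]

end Solutions

/-! ### Infima in the hypotheses and choice of the discount rate -/

section Constants

lemma gridPoint_mem (n : ℕ) [NeZero n] (k : ZMod n) : gridPoint n k ∈ Set.Icc (0 : ℝ) 1 :=
  (cell_mem k).1

lemma infInitial_le {u₀ : ℝ → ℝ} (h : ∀ x ∈ Set.Icc (0 : ℝ) 1, 0 ≤ u₀ x) {x : ℝ}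
    (hx : x ∈ Set.Icc (0 : ℝ) 1) : infInitial u₀ ≤ u₀ x :=
  ciInf_le (f := fun x : Set.Icc (0 : ℝ) 1 => u₀ x)
    ⟨0, by rintro _ ⟨y, rfl⟩; exact h y y.2⟩ ⟨x, hx⟩

lemma infSlope_sq_mul_sq_le {σ : ℝ → ℝ} (h0 : 0 ≤ infSlope σ) (x : ℝ) :
    infSlope σ ^ 2 * x ^ 2 ≤ σ x ^ 2 := by
  rcases eq_or_ne x 0 with rfl | hx
  · simpa using sq_nonneg (σ 0)
  · have h : infSlope σ ≤ |σ x / x| :=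
      ciInf_le (f := fun x : {x : ℝ // x ≠ 0} => |σ x / x|)
        ⟨0, by rintro _ ⟨y, rfl⟩; exact abs_nonneg _⟩ ⟨x, hx⟩
    have h2 := pow_le_pow_left₀ h0 h 2
    rwa [sq_abs, div_pow, le_div_iff₀ (by positivity)] at h2

/-- Choice of the discount rate for arbitrary parameters. -/
lemma exists_discount (a : ℝ) (ha : 0 ≤ a) :
    ∃ β : ℝ, 0 < β ∧ a * (3 / β + 12 / √β) ≤ 1 / 2 := by
  refine ⟨(1 + 30 * a) ^ 2, by positivity, ?_⟩
  rw [Real.sqrt_sq (by positivity)]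
  have hs : 1 ≤ 1 + 30 * a := by linarith
  have h1 : 3 / (1 + 30 * a) ^ 2 ≤ 3 / (1 + 30 * a) :=
    div_le_div_of_nonneg_left (by norm_num) (by positivity) (by nlinarith)
  calc a * (3 / (1 + 30 * a) ^ 2 + 12 / (1 + 30 * a))
      ≤ a * (3 / (1 + 30 * a) + 12 / (1 + 30 * a)) := by gcongr
    _ = 15 * a / (1 + 30 * a) := by ring
    _ ≤ 1 / 2 := by rw [div_le_div_iff₀ (by positivity) (by norm_num)]; linarith

/-- Choice of the discount rate with `√β` proportional to `p`, when the noise is bounded below. -/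
lemma discount_of_le {ℓ a p D : ℝ} (hℓ : 0 < ℓ) (hp : 2 ≤ p) (ha : ℓ ^ 2 ≤ a)
    (hD : D = 32 * (3 / (2 * ℓ ^ 2) + 12)) :
    16 * p * a * (3 / (D * p * a) ^ 2 + 12 / (D * p * a)) ≤ 1 / 2 := by
  have ha0 : 0 < a := lt_of_lt_of_le (by positivity) ha
  have hD1 : 1 ≤ D := by
    have : 0 < 3 / (2 * ℓ ^ 2) := by positivity
    linarith
  have hb : 2 * ℓ ^ 2 ≤ D * p * a := by
    have : 2 ≤ D * p := by nlinarith
    nlinarith [sq_nonneg ℓ]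
  have hb0 : 0 < D * p * a := by positivity
  have h1 : 3 / (D * p * a) ≤ 3 / (2 * ℓ ^ 2) :=
    div_le_div_of_nonneg_left (by norm_num) (by positivity) hb
  calc 16 * p * a * (3 / (D * p * a) ^ 2 + 12 / (D * p * a))
      = 16 / D * (3 / (D * p * a) + 12) := by field_simp
    _ ≤ 16 / D * (3 / (2 * ℓ ^ 2) + 12) := by gcongr
    _ = 1 / 2 := by
      rw [show 3 / (2 * ℓ ^ 2) + 12 = D / 32 by rw [hD]; ring]
      field_simp; norm_num

end Constants

end ThetaScheme

theorem mainTheorem4 (θ : ℝ) (hθ0 : 0 ≤ θ) (hθ1 : θ ≤ 1) :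
    ∀ ℓ : ℝ, 0 < ℓ → ∃ C : ℝ, 0 < C ∧
      ∀ (Ω : Type*) [MeasurableSpace Ω] (P : Measure Ω) [IsProbabilityMeasure P]
        (W : ℝ → ℝ → Ω → ℝ), ThetaScheme.IsBrownianSheet P W →
      ∀ (lam : ℝ) (σ u₀ : ℝ → ℝ) (L : ℝ≥0), 0 < lam → LipschitzWith L σ →
        Measurable (fun x : Set.Icc (0 : ℝ) 1 => u₀ x) →
        BddAbove (u₀ '' Set.Icc (0 : ℝ) 1) →
        (∀ x ∈ Set.Icc (0 : ℝ) 1, 0 ≤ u₀ x) →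
      ∀ (n : ℕ) (τ : ℝ), 3 ≤ n → 0 < τ → τ < 1 → ThetaScheme.StepSizeCondition θ n τ →
        (∃ U : ℕ → ZMod n → Ω → ℝ, ThetaScheme.IsSolution P W θ lam σ u₀ n τ U) ∧
        ∀ U : ℕ → ZMod n → Ω → ℝ, ThetaScheme.IsSolution P W θ lam σ u₀ n τ U →
          (((L : ℝ) = 0 ∨ ℓ ≤ lam * L) → ∀ p : ℝ, 2 ≤ p →
            ⨆ x ∈ Set.Icc (0 : ℝ) 1,
                ThetaScheme.upperLyapunov P τ (ThetaScheme.interpolate n U) p x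
              ≤ ((C * (L : ℝ) ^ 4 * lam ^ 4 * p ^ 3 : ℝ) : EReal)) ∧
          (0 < ThetaScheme.infInitial u₀ → 0 < ThetaScheme.infSlope σ →
            ThetaScheme.WeaklyIntermittent P τ (ThetaScheme.interpolate n U) ∧
            0 < Real.log (1 + lam ^ 2 * ThetaScheme.infSlope σ ^ 2 * τ) / τ ∧
            ((Real.log (1 + lam ^ 2 * ThetaScheme.infSlope σ ^ 2 * τ) / τ : ℝ) : EReal)
              ≤ ⨅ x ∈ Set.Icc (0 : ℝ) 1,
                  ThetaScheme.upperLyapunov P τ (ThetaScheme.interpolate n U) 2 x) := by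
  intro ℓ hℓ
  set D : ℝ := 32 * (3 / (2 * ℓ ^ 2) + 12) with hD
  have hD0 : 0 < D := by positivity
  refine ⟨D ^ 2 / 2, by positivity, ?_⟩
  intro Ω _ P _ W hW lam σ u₀ L hlam hσ _ _ hu₀ n τ hn hτ _ hstep
  have : NeZero n := ⟨by omega⟩
  refine ⟨⟨_, ThetaScheme.isSolution_noisePath hθ0 hτ⟩, fun U hU => ⟨fun hL p hp => ?_,
    fun hI hJ => ?_⟩⟩
  · refine iSup₂_le fun x _ => ?_
    rcases eq_or_ne (L : ℝ) 0 with hL0 | hL0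
    · -- additive noise: every positive rate bounds the exponent, hence so does zero
      have hp0 : 0 < p := by linarith
      have e : D ^ 2 / 2 * (L : ℝ) ^ 4 * lam ^ 4 * p ^ 3 = 0 := by rw [hL0]; ring
      rw [e]
      refine (EReal.le_of_forall_lt_iff_le (x := ((0 : ℝ) : EReal))).1 fun z hz => ?_
      have hz' : 0 < z := by exact_mod_cast hz
      have h := hU.upperLyapunov_le hW hσ hθ0 hτ hstep hp (β := 2 * z / p) (by positivity)
        (by rw [hL0]; norm_num) x
      rwa [show 2 * z / p * p / 2 = z by field_simp] at h
    · have hL1 : ℓ ≤ lam * L := hL.resolve_left hL0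
      have ha : ℓ ^ 2 ≤ lam ^ 2 * (L : ℝ) ^ 2 := by
        rw [← mul_pow]; exact pow_le_pow_left₀ hℓ.le hL1 2
      have hL2 : (0 : ℝ) < L := lt_of_le_of_ne L.coe_nonneg (Ne.symm hL0)
      have hβ : 0 < D * p * (lam ^ 2 * (L : ℝ) ^ 2) := by positivity
      have h := hU.upperLyapunov_le hW hσ hθ0 hτ hstep hp
        (β := (D * p * (lam ^ 2 * (L : ℝ) ^ 2)) ^ 2) (by positivity) (by
          rw [Real.sqrt_sq hβ.le]
          refine le_trans (le_of_eq ?_) (ThetaScheme.discount_of_le hℓ hp ha hD)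
          ring) x
      refine h.trans (le_of_eq ?_)
      congr 1; ring
  · have hpos : 0 < Real.log (1 + lam ^ 2 * ThetaScheme.infSlope σ ^ 2 * τ) / τ :=
      div_pos (Real.log_pos (by
        have : 0 < lam ^ 2 * ThetaScheme.infSlope σ ^ 2 * τ := by positivity
        linarith)) hτ
    have hlow := hU.le_upperLyapunov hW hσ.continuous hθ0 hτ hstep hlam hJ
      (ThetaScheme.infSlope_sq_mul_sq_le hJ.le) hI
      (fun k => ThetaScheme.infInitial_le hu₀ (ThetaScheme.gridPoint_mem n k))
    refine ⟨fun x _ => ⟨lt_of_lt_of_le (by exact_mod_cast hpos) (hlow x), fun p hp => ?_⟩, hpos,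
      le_iInf₂ fun x _ => hlow x⟩
    obtain ⟨β, hβ, h⟩ := ThetaScheme.exists_discount (16 * p * lam ^ 2 * L ^ 2) (by positivity)
    exact lt_of_le_of_lt (hU.upperLyapunov_le hW hσ hθ0 hτ hstep hp.le hβ
      (le_trans (le_of_eq (by ring)) h) x) (EReal.coe_lt_top _)
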